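/- Let $(X,d)$ be a complete metric space, $\lambda\in\mathbb R$, and let $\phi:X\to(-\infty,\infty]$ be lower semi-continuous with $D(\phi):=\{\phi<\infty\}\neq\emptyset$. A minimal geodesic from $x$ to $y$ is a curve $\gamma:[0,1]\to X$ with $\gamma(0)=x$, $\gamma(1)=y$ and $d(\gamma(s),\gamma(t))=|s-t|\,d(x,y)$ for all $s,t$. We say that a function $f:X\to(-\infty,\infty]$ is $c$-convex along such a $\gamma$ (where $f(x),f(y)<\infty$) if $f(\gamma(t))\le(1-t)f(x)+tf(y)-\frac c2(1-t)t\,d^2(x,y)$ for all $t\in[0,1]$. Assume that $\phi$ is $\lambda$-convex: any $x,y\in D(\phi)$ are joined by some minimal geodesic along which $\phi$ is $\lambda$-convex. The local slope of $\phi$ at $x\in D(\phi)$ is $|\nabla\phi|(x):=\limsup_{y\to x}\max\{\phi(x)-\phi(y),0\}/d(x,y)$ ($:=0$ if $x$ is isolated). For $\tau>0$ let $J^\phi_\tau(x)$ be the set of points $z\in X$ that attain $\phi_\tau(x):=\inf_{z\in X}\{\phi(z)+d^2(x,z)/(2\tau)\}$. A discrete solution from $x_0$ for a partition $0=t^0<t^1<\cdots\to\infty$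 is a sequence with $x^0=x_0$ and $x^k\in J^\phi_{t^k-t^{k-1}}(x^{k-1})$ for $k\ge1$; its interpolation is $\bar x(0)=x_0$, $\bar x(t)=x^k$ for $t\in(t^{k-1},t^k]$. A gradient curve of $\phi$ from $x_0$ is a curve $\xi:[0,\infty)\to X$ which is the pointwise limit of interpolations of discrete solutions from $x_0$ for some sequence of partitions with mesh $\sup_k(t^k-t^{k-1})$ tending to $0$. **Theorem.** Let $x_0\in D(\phi)$. (a) Assume either (I) $(X,d)$ is a $\mathrm{CAT}(1)$-space with $\operatorname{diam}X<\pi/2$, or (II) there are $K\in\mathbb R$ and a family $\Gamma$ of minimal geodesics joining any two points of $X$ such that: every $d^2(p,\cdot)$, $p\in X$, is $K$-convex along every $\gamma\in\Gamma$; $\phi$ is $\lambda$-convex along every $\gamma\in\Gamma$ with end points in $D(\phi)$; and for all $\gamma,\eta\in\Gamma$ with $\gamma(0)=\eta(0)=x$, $\gamma(1)=y$, $\eta(1)=z$ the following limits exist and satisfy $$\lim_{s\downarrow0}\frac{d^2(\gamma(s),z)-d^2(x,z)}{s}=\lim_{t\downarrow0}\frac{d^2(\eta(t),y)-d^2(x,y)}{t};$$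 and moreover $\phi$ is coercive: there is $\tau_*\in(0,\infty]$ such that $\phi_\tau(x)>-\infty$ and $J^\phi_\tau(x)\ne\emptyset$ for all $x\in X$ and $\tau\in(0,\tau_*)$. Then there is exactly one gradient curve $\xi$ of $\phi$ from $x_0$ and, writing $G(t,x_0):=\xi(t)$, $$|\nabla\phi|(x_0)=0\iff G(t,x_0)=x_0\ \text{ for all }t>0 .$$ (b) If $(X,d)$ is a $\mathrm{CAT}(1)$-space of arbitrary diameter, the same holds for the flow $G$ obtained by restarting: there is exactly one curve $\xi:[0,\infty)\to X$ with $\xi(0)=x_0$ for which there are times $0=s_0,s_1,\dots$ exhausting $[0,\infty)$ (the last one possibly $\infty$) such that, for each finite $s_i$, $\xi(s_i+\cdot)$ agrees up to time $s_{i+1}$ with a gradient curve from $\xi(s_i)$ of the restriction of $\phi$ to the closed ball of radius $\pi/6$ around $\xi(s_i)$ (set to $\infty$ outside it), $s_{i+1}$ being the first time that this gradient curve is at distance $\pi/6$ from $\xi(s_i)$ ($s_{i+1}=\infty$ if there is none). With $G(t,x_0):=\xi(t)$, $$|\nabla\phi|(x_0)=0\iff G(t,x_0)=x_0\ \text{ for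 all }t>0 .$$ -/

import Mathlib

open Set Filter Topology
open scoped NNReal ENNReal

noncomputable section

namespace GradFlow

/-! ### Geodesics and CAT(1)-spaces -/

/-- The restriction of `γ` to `[0,1]` is a minimal geodesic from `x` to `y`, for the distance `d`. -/
def IsMinGeodesic {Y : Type*} (d : Y → Y → ℝ) (γ : ℝ → Y) (x y : Y) : Prop :=
  γ 0 = x ∧ γ 1 = y ∧
    ∀ s ∈ Icc (0 : ℝ) 1, ∀ t ∈ Icc (0 : ℝ) 1, d (γ s) (γ t) = |s - t| * d x y

/-- The unit sphere in Euclidean 3-space. -/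
abbrev S2 : Type := Metric.sphere (0 : EuclideanSpace ℝ (Fin 3)) 1

/-- The angular (intrinsic Riemannian) distance on the unit sphere. -/
def sphereDist (a b : S2) : ℝ :=
  InnerProductGeometry.angle (a : EuclideanSpace ℝ (Fin 3)) (b : EuclideanSpace ℝ (Fin 3))

/-- CAT(1)-spaces: geodesic metric spaces in which every triangle of perimeter `< 2π` is at least as
thin as its comparison triangle in the unit sphere. The comparison triangle `x' y' z'` exists and is
unique up to rigid motions, and its side `γ'` is the unique minimal geodesic from `y'` to `z'`. -/
def IsCAT1 (X : Type*) [MetricSpace X] : Prop :=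
  (∀ x y : X, ∃ γ : ℝ → X, IsMinGeodesic dist γ x y) ∧
  ∀ x y z : X, dist x y + dist y z + dist z x < 2 * Real.pi →
    ∀ γ : ℝ → X, IsMinGeodesic dist γ y z →
      ∃ x' y' z' : S2, sphereDist x' y' = dist x y ∧ sphereDist y' z' = dist y z ∧
        sphereDist z' x' = dist z x ∧
        ∃ γ' : ℝ → S2, IsMinGeodesic sphereDist γ' y' z' ∧
          ∀ t ∈ Icc (0 : ℝ) 1, dist x (γ t) ≤ sphereDist x' (γ' t)

section Potential

variable {X : Type*} [MetricSpace X]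

/-! ### Potentials: the values are in `(-∞,∞]`, i.e. `⊥` is excluded wherever these are used. -/

/-- The effective domain `D(φ)`. -/
def dom (φ : X → EReal) : Set X := {x | φ x ≠ ⊤}

/-- The Moreau--Yosida approximation `φ_τ(x)`. -/
def moreauYosida (φ : X → EReal) (τ : ℝ) (x : X) : EReal :=
  ⨅ z : X, φ z + ((dist x z ^ 2 / (2 * τ) : ℝ) : EReal)

/-- The set of minimizers in the Moreau--Yosida approximation. -/
def proxSet (φ : X → EReal) (τ : ℝ) (x : X) : Set X :=
  {z | φ z + ((dist x z ^ 2 / (2 * τ) : ℝ) : EReal) = moreauYosida φ τ x}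

/-- Coercivity; the threshold `τs` ranges over `(0,∞]`. -/
def Coercive (φ : X → EReal) : Prop :=
  ∃ τs : ℝ≥0∞, 0 < τs ∧ ∀ (x : X) (τ : ℝ), 0 < τ → ENNReal.ofReal τ < τs →
    moreauYosida φ τ x ≠ ⊥ ∧ (proxSet φ τ x).Nonempty

/-- The `c`-convexity inequality of `φ` along the curve `γ` joining the points `x, y` of `D(φ)`. -/
def ConvexAlong (φ : X → EReal) (c : ℝ) (γ : ℝ → X) (x y : X) : Prop :=
  ∀ t ∈ Icc (0 : ℝ) 1, φ (γ t) ≤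
    (((1 - t) * (φ x).toReal + t * (φ y).toReal - c / 2 * (1 - t) * t * dist x y ^ 2 : ℝ) : EReal)

/-- `φ` is `c`-convex: any two points of `D(φ)` are joined by some minimal geodesic along which the
`c`-convexity inequality holds. -/
def IsLambdaConvex (φ : X → EReal) (c : ℝ) : Prop :=
  ∀ x ∈ dom φ, ∀ y ∈ dom φ, ∃ γ : ℝ → X, IsMinGeodesic dist γ x y ∧ ConvexAlong φ c γ x y

/-- Commutativity for `γ` from `x` to `y` and `η` from `x` to `z`: the one-sided derivatives at `0` of
`d²(γ(s),z)` and of `d²(η(t),y)` exist and are equal. -/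
def CommuteAlong (γ η : ℝ → X) (x y z : X) : Prop :=
  ∃ L : ℝ,
    Tendsto (fun s : ℝ => (dist (γ s) z ^ 2 - dist x z ^ 2) / s) (𝓝[>] 0) (𝓝 L) ∧
    Tendsto (fun t : ℝ => (dist (η t) y ^ 2 - dist x y ^ 2) / t) (𝓝[>] 0) (𝓝 L)

/-- There is a family `Γ` of minimal geodesics joining any two points of the space, such that, along
this same family, commutativity holds, all squared distance functions `d²(p,·)` are `K`-convex, and
`φ` is `c`-convex. -/
def CommutativeSetting (φ : X → EReal) (c K : ℝ) : Prop :=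
  ∃ Γ : Set (ℝ → X),
    (∀ γ ∈ Γ, IsMinGeodesic dist γ (γ 0) (γ 1)) ∧
    (∀ x y : X, ∃ γ ∈ Γ, γ 0 = x ∧ γ 1 = y) ∧
    (∀ γ ∈ Γ, ∀ η ∈ Γ, γ 0 = η 0 → CommuteAlong γ η (γ 0) (γ 1) (η 1)) ∧
    (∀ γ ∈ Γ, ∀ p : X, ConvexAlong (fun w => ((dist p w ^ 2 : ℝ) : EReal)) K γ (γ 0) (γ 1)) ∧
    (∀ γ ∈ Γ, γ 0 ∈ dom φ → γ 1 ∈ dom φ → ConvexAlong φ c γ (γ 0) (γ 1))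

/-- The descending local slope `|∇φ|(x) = limsup_{y → x} max{φ(x) - φ(y), 0} / d(x,y)`
(it is `0` at isolated points). -/
def localSlope (φ : X → EReal) (x : X) : ℝ≥0∞ :=
  limsup (fun y => (max (φ x - φ y) 0).toENNReal / edist x y) (𝓝[≠] x)

/-! ### Discrete solutions and gradient curves -/

/-- Partitions `0 = p 0 < p 1 < ⋯ → ∞` of `[0,∞)`. -/
def IsPartition (p : ℕ → ℝ) : Prop :=
  p 0 = 0 ∧ StrictMono p ∧ Tendsto p atTop atTop

/-- The mesh of a partition. -/
def mesh (p : ℕ → ℝ) : ℝ≥0∞ := ⨆ k : ℕ, ENNReal.ofReal (p (k + 1) - p k)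

/-- Discrete solutions starting from `x₀` associated with the partition `p`. -/
def IsDiscreteSolution (φ : X → EReal) (x₀ : X) (p : ℕ → ℝ) (x : ℕ → X) : Prop :=
  x 0 = x₀ ∧ ∀ k : ℕ, x (k + 1) ∈ proxSet φ (p (k + 1) - p k) (x k)

/-- The interpolated curve: it is `x 0` at `t = 0` and `x k` for `p (k-1) < t ≤ p k`. -/
def interpolate (p : ℕ → ℝ) (x : ℕ → X) (t : ℝ≥0) : X := x (sInf {k : ℕ | (t : ℝ) ≤ p k})

/-- `ξ` is a gradient curve of `φ` starting from `x₀`: it is the pointwise limit of the interpolations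
of discrete solutions starting from `x₀`, along a sequence of partitions with mesh tending to `0`. -/
def IsGradientCurve (φ : X → EReal) (x₀ : X) (ξ : ℝ≥0 → X) : Prop :=
  ∃ (p : ℕ → ℕ → ℝ) (x : ℕ → ℕ → X),
    (∀ i, IsPartition (p i)) ∧ Tendsto (fun i => mesh (p i)) atTop (𝓝 0) ∧
    (∀ i, IsDiscreteSolution φ x₀ (p i) (x i)) ∧
    ∀ t : ℝ≥0, Tendsto (fun i => interpolate (p i) (x i) t) atTop (𝓝 (ξ t))

/-- The gradient flow operator: `gradientFlow φ t x₀ = ξ t` for the gradient curve `ξ` starting from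
`x₀` (to be used when this curve exists and is unique). -/
def gradientFlow (φ : X → EReal) (t : ℝ≥0) (x₀ : X) : X :=
  (@Classical.epsilon (ℝ≥0 → X) ⟨fun _ => x₀⟩ (IsGradientCurve φ x₀)) t

/-! ### The flow obtained by restarting the construction in balls of radius `π / 6` -/

open Classical in
/-- The potential `φ` restricted to the closed ball of centre `c` and radius `π / 6`
(and put equal to `∞` elsewhere). -/
def restrictBall (φ : X → EReal) (c : X) : X → EReal :=
  fun z => if dist z c ≤ Real.pi / 6 then φ z else ⊤

/-- The first time (possibly `∞`) at which `η` is at distance `π / 6` from `c`. -/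
def hittingTime (c : X) (η : ℝ≥0 → X) : ℝ≥0∞ :=
  ⨅ (t : ℝ≥0) (_ : dist (η t) c = Real.pi / 6), (t : ℝ≥0∞)

/-- `ξ` is the curve obtained from `x₀` by restarting: there are times `0 = s 0, s 1, …` exhausting
`[0,∞)` (the last one may be `∞`), such that from each finite `s i` on, `ξ` follows a gradient
curve `η` of `φ` restricted to the `π / 6`-ball around `ξ (s i)`, until `η` hits the boundary of
that ball, at the time `s (i+1)`. -/
def IsRestartedCurve (φ : X → EReal) (x₀ : X) (ξ : ℝ≥0 → X) : Prop :=
  ξ 0 = x₀ ∧ ∃ s : ℕ → ℝ≥0∞, s 0 = 0 ∧ (∀ t : ℝ≥0, ∃ i, (t : ℝ≥0∞) < s i) ∧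
    ∀ i, ∀ a : ℝ≥0, s i = a →
      ∃ η : ℝ≥0 → X, IsGradientCurve (restrictBall φ (ξ a)) (ξ a) η ∧
        s (i + 1) = s i + hittingTime (ξ a) η ∧
        ∀ t : ℝ≥0, ((a + t : ℝ≥0) : ℝ≥0∞) ≤ s (i + 1) → ξ (a + t) = η t

/-- The flow operator given by the restarted curves (to be used when these exist and are unique). -/
def restartedFlow (φ : X → EReal) (t : ℝ≥0) (x₀ : X) : X :=
  (@Classical.epsilon (ℝ≥0 → X) ⟨fun _ => x₀⟩ (IsRestartedCurve φ x₀)) t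

end Potential

end GradFlow

end

open GradFlow

/-! In both settings a minimizing-movement step satisfies a discrete evolution variational
inequality: moving a minimizer towards a competitor and letting the displacement shrink gives, in a
CAT(1)-space, the first variation formula of the comparison sphere, and in the commutative setting
exactly the derivative that commutativity rewrites as one along the geodesic from the minimizer to
the previous node, where the `K`-convexity of `d²` applies. Applied to two discrete solutions at
once, these inequalities become a double-index recursion of Kobayashi type for `d²(xᵢ, yⱼ)`, with a
supersolution built from `√((t - s)² + ε (t + s))`. Hence discrete solutions are Cauchy as the mesh
tends to `0`, which gives existence and uniqueness of the gradient curve.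

For the stationarity criterion, vanishing of the slope at `x₀` and constancy of the flow are both
equivalent to a global bound `φ(x₀) ≤ φ(y) + c d²(x₀, y)`: the first by `λ`-convexity, the second by
the integrated variational inequality.

In a CAT(1)-space of arbitrary diameter, balls of radius `π / 6` are convex of diameter less than
`π / 2`. The restart times cannot accumulate, since each restart costs a fixed distance `π / 6`,
while `d²(ξ(s), ξ(t)) ≤ 2 (t - s) (φ(ξ(s)) - φ(ξ(t)))` and `φ` is bounded below by a quadratic.
-/

namespace GradFlow

/-! ### Discrete solutions -/

section Potential

variable {X : Type*} {φ : X → EReal}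

/-- The real value `φ x` of the potential; it has the junk value `0` outside `D(φ)`. -/
abbrev val (φ : X → EReal) (x : X) : ℝ := (φ x).toReal

lemma coe_val (hbot : ∀ x, φ x ≠ ⊥) {x : X} (hx : x ∈ dom φ) : (val φ x : EReal) = φ x :=
  EReal.coe_toReal hx (hbot x)

lemma mem_dom_of_le {x : X} {c : ℝ} (h : φ x ≤ c) : x ∈ dom φ :=
  (h.trans_lt (EReal.coe_lt_top c)).ne

lemma val_le_of_le (hbot : ∀ x, φ x ≠ ⊥) {x : X} {c : ℝ} (h : φ x ≤ c) : val φ x ≤ c := by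
  rw [← coe_val hbot (mem_dom_of_le h)] at h
  exact_mod_cast h

lemma mem_dom_and_val_le_of_tendsto [TopologicalSpace X] (hbot : ∀ x, φ x ≠ ⊥)
    (hlsc : LowerSemicontinuous φ) {ι : Type*} {l : Filter ι} [NeBot l] {u : ι → X} {x : X}
    {b : ι → ℝ} {c : ℝ} (hu : Tendsto u l (𝓝 x)) (hd : ∀ᶠ i in l, u i ∈ dom φ)
    (h : ∀ᶠ i in l, val φ (u i) ≤ b i) (hb : Tendsto b l (𝓝 c)) :
    x ∈ dom φ ∧ val φ x ≤ c := by
  suffices key : φ x ≤ c from ⟨mem_dom_of_le key, val_le_of_le hbot key⟩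
  by_contra! hc
  obtain ⟨r, hcr, hrx⟩ := EReal.lt_iff_exists_real_btwn.1 hc
  obtain ⟨i, hri, hbr, hid, hib⟩ := ((hu.eventually (hlsc x _ hrx)).and
    ((hb.eventually (gt_mem_nhds (EReal.coe_lt_coe_iff.1 hcr))).and (hd.and h))).exists
  rw [← coe_val hbot hid] at hri
  exact (EReal.coe_lt_coe_iff.1 hri).not_ge (hib.trans hbr.le)

lemma mem_proxSet_iff [MetricSpace X] (hbot : ∀ x, φ x ≠ ⊥) (hne : (dom φ).Nonempty) {τ : ℝ}
    {x z : X} : z ∈ proxSet φ τ x ↔ z ∈ dom φ ∧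
      ∀ y ∈ dom φ, val φ z + dist x z ^ 2 / (2 * τ) ≤ val φ y + dist x y ^ 2 / (2 * τ) := by
  have hcoe {w : X} (hw : w ∈ dom φ) : φ w + ((dist x w ^ 2 / (2 * τ) : ℝ) : EReal) =
      ((val φ w + dist x w ^ 2 / (2 * τ) : ℝ) : EReal) := by
    rw [EReal.coe_add, coe_val hbot hw]
  constructor
  · intro hz
    have hmin (y : X) : φ z + ((dist x z ^ 2 / (2 * τ) : ℝ) : EReal) ≤
        φ y + ((dist x y ^ 2 / (2 * τ) : ℝ) : EReal) := hz.trans_le (iInf_le _ y)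
    have hzd : z ∈ dom φ := by
      obtain ⟨w, hw⟩ := hne
      intro hz_top
      have h := hmin w
      rw [hz_top, EReal.top_add_coe, hcoe hw] at h
      exact EReal.coe_ne_top _ (top_le_iff.1 h)
    refine ⟨hzd, fun y hy => ?_⟩
    have h := hmin y
    rwa [hcoe hzd, hcoe hy, EReal.coe_le_coe_iff] at h
  · rintro ⟨hz, hmin⟩
    refine le_antisymm (le_iInf fun y => ?_) (iInf_le _ z)
    by_cases hy : y ∈ dom φ
    · rw [hcoe hz, hcoe hy]
      exact EReal.coe_le_coe_iff.2 (hmin y hy)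
    · rw [not_not.1 hy, EReal.top_add_coe]
      exact le_top

end Potential

section Partition

variable {p : ℕ → ℝ}

lemma IsPartition.step_pos (hp : IsPartition p) (k : ℕ) : 0 < p (k + 1) - p k :=
  sub_pos.2 (hp.2.1 k.lt_succ_self)

lemma IsPartition.monotone (hp : IsPartition p) : Monotone p :=
  hp.2.1.monotone

lemma IsPartition.nonneg (hp : IsPartition p) (k : ℕ) : 0 ≤ p k :=
  hp.1 ▸ hp.monotone k.zero_le

lemma IsPartition.nonneg_of_step_le (hp : IsPartition p) {ε : ℝ}
    (hε : ∀ k, p (k + 1) - p k ≤ ε) : 0 ≤ ε :=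
  (hp.step_pos 0).le.trans (hε 0)

lemma isPartition_natCast_mul {h : ℝ} (hh : 0 < h) : IsPartition fun k : ℕ => k * h :=
  ⟨by simp, Nat.strictMono_cast.mul_const hh, tendsto_natCast_atTop_atTop.atTop_mul_const hh⟩

end Partition

lemma add_sq_le_add_mul_add {p q t s A B : ℝ} (ht : 0 ≤ t) (hs : 0 ≤ s) (hA : 0 ≤ A)
    (hB : 0 ≤ B) (hp : p ^ 2 ≤ t * A) (hq : q ^ 2 ≤ s * B) :
    (p + q) ^ 2 ≤ (t + s) * (A + B) := by
  have hcross : 2 * (p * q) ≤ t * B + s * A := by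
    refine abs_le_of_sq_le_sq' ?_ (by positivity) |>.2
    have : p ^ 2 * q ^ 2 ≤ (t * A) * (s * B) := by gcongr
    nlinarith [sq_nonneg (t * B - s * A)]
  nlinarith

lemma le_mul_exp_of_le_add_mul {a b r : ℝ} (hb : 0 ≤ b) (hr : 0 ≤ r) (hr' : r ≤ 1 / 2)
    (h : a ≤ b + r * a) : a ≤ b * Real.exp (2 * r) := by
  have hinv : 1 ≤ (1 + 2 * r) * (1 - r) := by nlinarith
  have hle : a ≤ b * (1 + 2 * r) := by
    refine le_of_mul_le_mul_right ?_ (by linarith : 0 < 1 - r)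
    calc a * (1 - r) ≤ b := by linarith
      _ ≤ b * ((1 + 2 * r) * (1 - r)) := le_mul_of_one_le_right hb hinv
      _ = b * (1 + 2 * r) * (1 - r) := by ring
  refine hle.trans (mul_le_mul_of_nonneg_left ?_ hb)
  linarith [Real.add_one_le_exp (2 * r)]

section DiscreteSolution

variable {X : Type*} [MetricSpace X] {φ : X → EReal} {x₀ : X} {p : ℕ → ℝ} {x : ℕ → X}

namespace IsDiscreteSolution

lemma mem_dom (hx : IsDiscreteSolution φ x₀ p x) (hbot : ∀ x, φ x ≠ ⊥) (hx₀ : x₀ ∈ dom φ)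
    (k : ℕ) : x k ∈ dom φ := by
  induction k with
  | zero => rwa [hx.1]
  | succ k ih => exact ((mem_proxSet_iff hbot ⟨_, ih⟩).1 (hx.2 k)).1

lemma sq_dist_succ_le (hx : IsDiscreteSolution φ x₀ p x) (hbot : ∀ x, φ x ≠ ⊥)
    (hx₀ : x₀ ∈ dom φ) (hp : IsPartition p) (k : ℕ) :
    dist (x k) (x (k + 1)) ^ 2 ≤ 2 * (p (k + 1) - p k) * (val φ (x k) - val φ (x (k + 1))) := by
  have hk := hx.mem_dom hbot hx₀ k
  have hmin := ((mem_proxSet_iff hbot ⟨_, hk⟩).1 (hx.2 k)).2 _ hk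
  rw [dist_self, zero_pow two_ne_zero, zero_div, add_zero, ← le_sub_iff_add_le',
    div_le_iff₀ (mul_pos two_pos (hp.step_pos k))] at hmin
  linarith

lemma val_antitone (hx : IsDiscreteSolution φ x₀ p x) (hbot : ∀ x, φ x ≠ ⊥) (hx₀ : x₀ ∈ dom φ)
    (hp : IsPartition p) : Antitone fun k => val φ (x k) := by
  refine antitone_nat_of_succ_le fun k => sub_nonneg.1 ?_
  have h := (sq_nonneg _).trans (hx.sq_dist_succ_le hbot hx₀ hp k)
  exact nonneg_of_mul_nonneg_right h (mul_pos two_pos (hp.step_pos k))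

lemma val_succ_le (hx : IsDiscreteSolution φ x₀ p x) (hbot : ∀ x, φ x ≠ ⊥) (hx₀ : x₀ ∈ dom φ)
    (hp : IsPartition p) (k : ℕ) : val φ (x (k + 1)) ≤ val φ (x k) :=
  hx.val_antitone hbot hx₀ hp k.le_succ

lemma val_le (hx : IsDiscreteSolution φ x₀ p x) (hbot : ∀ x, φ x ≠ ⊥) (hx₀ : x₀ ∈ dom φ)
    (hp : IsPartition p) (k : ℕ) : val φ (x k) ≤ val φ x₀ :=
  (hx.val_antitone hbot hx₀ hp k.zero_le).trans_eq (congrArg (val φ) hx.1)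

lemma sq_dist_le (hx : IsDiscreteSolution φ x₀ p x) (hbot : ∀ x, φ x ≠ ⊥) (hx₀ : x₀ ∈ dom φ)
    (hp : IsPartition p) {j k : ℕ} (hjk : j ≤ k) :
    dist (x j) (x k) ^ 2 ≤ 2 * (p k - p j) * (val φ (x j) - val φ (x k)) := by
  induction k, hjk using Nat.le_induction with
  | base => simp
  | succ k hjk ih =>
    have hτ := hp.step_pos k
    have hpjk := sub_nonneg.2 (hp.monotone hjk)
    calc dist (x j) (x (k + 1)) ^ 2 ≤ (dist (x j) (x k) + dist (x k) (x (k + 1))) ^ 2 := by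
          gcongr; exact dist_triangle _ _ _
      _ ≤ (2 * (p k - p j) + 2 * (p (k + 1) - p k)) *
          (val φ (x j) - val φ (x k) + (val φ (x k) - val φ (x (k + 1)))) :=
        add_sq_le_add_mul_add (by positivity) (by positivity)
          (sub_nonneg.2 (hx.val_antitone hbot hx₀ hp hjk))
          (sub_nonneg.2 (hx.val_succ_le hbot hx₀ hp k)) ih (hx.sq_dist_succ_le hbot hx₀ hp k)
      _ = 2 * (p (k + 1) - p j) * (val φ (x j) - val φ (x (k + 1))) := by ring

lemma sq_dist_start_le (hx : IsDiscreteSolution φ x₀ p x) (hbot : ∀ x, φ x ≠ ⊥)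
    (hx₀ : x₀ ∈ dom φ) (hp : IsPartition p) (k : ℕ) :
    dist x₀ (x k) ^ 2 ≤ 2 * p k * (val φ x₀ - val φ (x k)) := by
  simpa only [hx.1, hp.1, sub_zero] using hx.sq_dist_le hbot hx₀ hp k.zero_le

end IsDiscreteSolution

/-- The setting in which the minimizing movement scheme is shown to converge: minimizers exist for
small time steps, and every step from `x` to a minimizer `z` satisfies a discrete evolution
variational inequality, where the defect `C d²(x,z)` is of higher order along discrete solutions and
`L` bounds the negative part of the convexity. -/
structure EVISetting (φ : X → EReal) (C L : ℝ) : Prop where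
  ne_bot : ∀ x, φ x ≠ ⊥
  lowerSemicontinuous : LowerSemicontinuous φ
  C_nonneg : 0 ≤ C
  L_nonneg : 0 ≤ L
  exists_prox : ∃ τs > 0, ∀ x ∈ dom φ, ∀ τ, 0 < τ → τ < τs → (proxSet φ τ x).Nonempty
  evi : ∀ τ, 0 < τ → ∀ x ∈ dom φ, ∀ y ∈ dom φ, ∀ z ∈ proxSet φ τ x,
    dist z y ^ 2 ≤ dist x y ^ 2 + C * dist x z ^ 2 + 2 * τ * (val φ y - val φ z)
      + L * τ * dist z y ^ 2

variable {C L : ℝ}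

lemma IsDiscreteSolution.evi (hx : IsDiscreteSolution φ x₀ p x) (S : EVISetting φ C L)
    (hx₀ : x₀ ∈ dom φ) (hp : IsPartition p) (k : ℕ) {y : X} (hy : y ∈ dom φ) :
    dist (x (k + 1)) y ^ 2 ≤ dist (x k) y ^ 2
      + (p (k + 1) - p k) * (2 * C * (val φ (x k) - val φ (x (k + 1)))
        + 2 * (val φ y - val φ (x (k + 1))) + L * dist (x (k + 1)) y ^ 2) := by
  have hevi := S.evi _ (hp.step_pos k) _ (hx.mem_dom S.ne_bot hx₀ k) _ hy _ (hx.2 k)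
  have hdefect := mul_le_mul_of_nonneg_left (hx.sq_dist_succ_le S.ne_bot hx₀ hp k) S.C_nonneg
  linarith

namespace EVISetting

lemma exists_quadratic_lower_bound (S : EVISetting φ C L) {x : X} (hx : x ∈ dom φ) :
    ∃ A B : ℝ, 0 < A ∧ 0 < B ∧ ∀ y ∈ dom φ, val φ x - val φ y ≤ A + B * dist x y ^ 2 := by
  obtain ⟨τs, hτs, hprox⟩ := S.exists_prox
  obtain ⟨z, hz⟩ := hprox x hx (τs / 2) (by positivity) (by linarith)
  have hmin := ((mem_proxSet_iff S.ne_bot ⟨x, hx⟩).1 hz).2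
  refine ⟨|val φ x - val φ z| + 1, 1 / τs, by positivity, by positivity, fun y hy => ?_⟩
  have hzy := hmin y hy
  rw [mul_div_cancel₀ _ (two_ne_zero' ℝ)] at hzy
  have hz_nonneg : 0 ≤ dist x z ^ 2 / τs := by positivity
  rw [one_div_mul_eq_div]
  linarith [le_abs_self (val φ x - val φ z)]

lemma quadratic_growth_step (S : EVISetting φ C L) (hx₀ : x₀ ∈ dom φ) (hp : IsPartition p)
    (hx : IsDiscreteSolution φ x₀ p x) {A B : ℝ} (hA : 0 ≤ A) (hB : 0 ≤ B)
    (hAB : ∀ y ∈ dom φ, val φ x₀ - val φ y ≤ A + B * dist x₀ y ^ 2) (k : ℕ) :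
    A + B * dist x₀ (x (k + 1)) ^ 2 ≤ A + B * dist x₀ (x k) ^ 2 +
      (2 * (1 + C) * B + L) * (p (k + 1) - p k) * (A + B * dist x₀ (x (k + 1)) ^ 2) := by
  have hevi := hx.evi S hx₀ hp k hx₀
  rw [dist_comm (x (k + 1)), dist_comm (x k)] at hevi
  have hτ := (hp.step_pos k).le
  have hval := hx.val_le S.ne_bot hx₀ hp k
  have hlower := hAB _ (hx.mem_dom S.ne_bot hx₀ (k + 1))
  set D := dist x₀ (x (k + 1)) ^ 2
  have hC := S.C_nonneg
  have hrate : 2 * C * (val φ (x k) - val φ (x (k + 1))) + 2 * (val φ x₀ - val φ (x (k + 1)))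
      + L * D ≤ 2 * (1 + C) * (A + B * D) + L * D := by nlinarith
  have hLA := mul_nonneg S.L_nonneg hA
  nlinarith [mul_le_mul_of_nonneg_left hrate (mul_nonneg hτ hB), mul_nonneg hτ hLA]

lemma exists_drop_bound (S : EVISetting φ C L) {x₀ : X} (hx₀ : x₀ ∈ dom φ) (T : ℝ) :
    ∃ ε₀ > 0, ∃ M ≥ 0, ∀ p x, IsPartition p → IsDiscreteSolution φ x₀ p x →
      (∀ k, p (k + 1) - p k ≤ ε₀) → ∀ k, p k ≤ T → val φ x₀ - val φ (x k) ≤ M := by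
  obtain ⟨A, B, hA, hB, hAB⟩ := S.exists_quadratic_lower_bound hx₀
  have hC := S.C_nonneg
  have hL := S.L_nonneg
  set R := 2 * (1 + C) * B + L
  have : 0 < R := by positivity
  refine ⟨1 / (2 * R), by positivity, A * Real.exp (2 * R * T), by positivity, ?_⟩
  intro p x hp hx hmesh k hk
  have hgrowth (k : ℕ) : A + B * dist x₀ (x k) ^ 2 ≤ A * Real.exp (2 * R * p k) := by
    induction k with
    | zero => simp [hx.1, hp.1]
    | succ k ih =>
      have hτ := hp.step_pos k
      have hsmall : R * (p (k + 1) - p k) ≤ 1 / 2 := by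
        have := hmesh k
        rw [le_div_iff₀ (by positivity)] at this
        linarith
      calc A + B * dist x₀ (x (k + 1)) ^ 2
          ≤ (A + B * dist x₀ (x k) ^ 2) * Real.exp (2 * (R * (p (k + 1) - p k))) :=
          le_mul_exp_of_le_add_mul (by positivity) (by positivity) hsmall
            (S.quadratic_growth_step hx₀ hp hx hA.le hB.le hAB k)
        _ ≤ A * Real.exp (2 * R * p k) * Real.exp (2 * (R * (p (k + 1) - p k))) := by gcongr
        _ = A * Real.exp (2 * R * p (k + 1)) := by
          rw [mul_assoc, ← Real.exp_add]; ring_nf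
  calc val φ x₀ - val φ (x k) ≤ A + B * dist x₀ (x k) ^ 2 := hAB _ (hx.mem_dom S.ne_bot hx₀ k)
    _ ≤ A * Real.exp (2 * R * p k) := hgrowth k
    _ ≤ A * Real.exp (2 * R * T) := by gcongr

end EVISetting

end DiscreteSolution

/-! ### Comparison of two discrete solutions -/

section DoubleIndex

lemma kobayashi_sqrt_step {D σ τ ε S : ℝ} (hσ : 0 ≤ σ) (hτ : 0 ≤ τ) (hσε : σ ≤ ε) (hτε : τ ≤ ε)
    (hS : σ + τ ≤ S) :
    σ * √((D - τ) ^ 2 + ε * (S - τ)) + τ * √((D + σ) ^ 2 + ε * (S - σ)) ≤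
      (σ + τ) * √(D ^ 2 + ε * S) := by
  have hε : 0 ≤ ε := hσ.trans hσε
  set P := (D - τ) ^ 2 + ε * (S - τ) with hP
  set Q := (D + σ) ^ 2 + ε * (S - σ) with hQ
  set R := D ^ 2 + ε * S with hR
  have hP0 : 0 ≤ P := add_nonneg (sq_nonneg _) (mul_nonneg hε (by linarith))
  have hQ0 : 0 ≤ Q := add_nonneg (sq_nonneg _) (mul_nonneg hε (by linarith))
  have hR0 : 0 ≤ R := add_nonneg (sq_nonneg _) (mul_nonneg hε (by linarith))
  have hconcave : (σ * √P + τ * √Q) ^ 2 ≤ (σ + τ) * (σ * P + τ * Q) := by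
    have hcross := mul_nonneg (mul_nonneg hσ hτ) (sq_nonneg (√P - √Q))
    rw [← Real.sq_sqrt hP0, ← Real.sq_sqrt hQ0, Real.sqrt_sq (Real.sqrt_nonneg P),
      Real.sqrt_sq (Real.sqrt_nonneg Q)]
    linarith
  have haverage : σ * P + τ * Q ≤ (σ + τ) * R := by
    have : (σ + τ) * R - (σ * P + τ * Q) = σ * τ * ((ε - σ) + (ε - τ)) := by
      rw [hP, hQ, hR]; ring
    have : 0 ≤ σ * τ * ((ε - σ) + (ε - τ)) :=
      mul_nonneg (by positivity) (add_nonneg (sub_nonneg.2 hσε) (sub_nonneg.2 hτε))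
    linarith
  refine abs_le_of_sq_le_sq' ?_ (by positivity) |>.2
  calc (σ * √P + τ * √Q) ^ 2 ≤ (σ + τ) * (σ * P + τ * Q) := hconcave
    _ ≤ (σ + τ) * ((σ + τ) * R) := by gcongr
    _ = ((σ + τ) * √R) ^ 2 := by rw [mul_pow, Real.sq_sqrt hR0]; ring

/-- Implicit Grönwall step for a weighted average: the growth over the harmonic-type step
`h = τσ / (σ + τ)`, which is at most `σ` and at most `τ`, is paid for by the two older exponents. -/
lemma weighted_gronwall_step {L σ τ a a₁ a₂ W W₁ W₂ d G : ℝ} (hL : 0 ≤ L) (hσ : 0 < σ)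
    (hτ : 0 < τ) (hLσ : 4 * L * σ ≤ 1) (hG : 4 * L * σ ≤ G) (hd : 0 ≤ d) (hW₁ : 0 ≤ W₁)
    (hW₂ : 0 ≤ W₂) (h : (σ + τ) * a ≤ σ * a₁ + τ * a₂ + d + 2 * L * (τ * σ) * a)
    (h₁ : a₁ ≤ Real.exp (G - 4 * L * τ) * W₁) (h₂ : a₂ ≤ Real.exp (G - 4 * L * σ) * W₂)
    (hW : σ * W₁ + τ * W₂ + d ≤ (σ + τ) * W) :
    a ≤ Real.exp G * W := by
  have hστ : 0 < σ + τ := by positivity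
  obtain ⟨h', hmul⟩ : ∃ h', (σ + τ) * h' = τ * σ := ⟨_, mul_div_cancel₀ _ hστ.ne'⟩
  have hh0 : 0 ≤ h' := nonneg_of_mul_nonneg_right (hmul ▸ by positivity) hστ
  have hhτ : h' ≤ τ := le_of_mul_le_mul_left (by nlinarith) hστ
  have hhσ : h' ≤ σ := le_of_mul_le_mul_left (by nlinarith) hστ
  have hLh : L * h' ≤ L * σ := by gcongr
  set F := Real.exp (G - 4 * L * h') with hF
  have hF1 : 1 ≤ F := Real.one_le_exp_iff.2 (by linarith)
  have hW0 : 0 ≤ W := nonneg_of_mul_nonneg_right (le_trans (by positivity) hW) hστ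
  have hbase : σ * a₁ + τ * a₂ + d ≤ (σ + τ) * (F * W) :=
    calc σ * a₁ + τ * a₂ + d ≤ σ * (F * W₁) + τ * (F * W₂) + F * d := by
          gcongr
          · exact h₁.trans (by rw [hF]; gcongr)
          · exact h₂.trans (by rw [hF]; gcongr)
          · exact le_mul_of_one_le_left hd hF1
      _ = F * (σ * W₁ + τ * W₂ + d) := by ring
      _ ≤ F * ((σ + τ) * W) := by gcongr
      _ = (σ + τ) * (F * W) := by ring
  have himplicit : a ≤ F * W + 2 * L * h' * a := by
    refine le_of_mul_le_mul_left ?_ hστ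
    calc (σ + τ) * a ≤ (σ + τ) * (F * W) + 2 * L * (τ * σ) * a := by linarith
      _ = (σ + τ) * (F * W + 2 * L * h' * a) := by rw [← hmul]; ring
  calc a ≤ F * W * Real.exp (2 * (2 * L * h')) :=
        le_mul_exp_of_le_add_mul (by positivity) (by positivity) (by linarith) himplicit
    _ = Real.exp G * W := by rw [hF, mul_right_comm, ← Real.exp_add]; ring_nf

lemma double_index_comparison {t s : ℕ → ℝ} {a W d : ℕ → ℕ → ℝ} {L : ℝ} {K J : ℕ}
    (ht : IsPartition t) (hs : IsPartition s) (hL : 0 ≤ L)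
    (hLs : ∀ j, 4 * L * (s (j + 1) - s j) ≤ 1) (hd : ∀ k j, 0 ≤ d k j) (hW : ∀ k j, 0 ≤ W k j)
    (hleft : ∀ k ≤ K, a k 0 ≤ W k 0) (hbottom : ∀ j ≤ J, a 0 j ≤ W 0 j)
    (hsub : ∀ k j, ((s (j + 1) - s j) + (t (k + 1) - t k)) * a (k + 1) (j + 1) ≤
      (s (j + 1) - s j) * a k (j + 1) + (t (k + 1) - t k) * a (k + 1) j + d k j +
      2 * L * ((t (k + 1) - t k) * (s (j + 1) - s j)) * a (k + 1) (j + 1))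
    (hsuper : ∀ k j, (s (j + 1) - s j) * W k (j + 1) + (t (k + 1) - t k) * W (k + 1) j + d k j ≤
      ((s (j + 1) - s j) + (t (k + 1) - t k)) * W (k + 1) (j + 1)) :
    ∀ k ≤ K, ∀ j ≤ J, a k j ≤ Real.exp (4 * L * (t k + s j)) * W k j := by
  have hweight (k j : ℕ) : W k j ≤ Real.exp (4 * L * (t k + s j)) * W k j := by
    have := ht.nonneg k
    have := hs.nonneg j
    exact le_mul_of_one_le_left (hW k j) (Real.one_le_exp (by positivity))
  intro k
  induction k with
  | zero => exact fun _ j hj => (hbottom j hj).trans (hweight 0 j)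
  | succ k ihk =>
    intro hk j
    induction j with
    | zero => exact fun _ => (hleft _ hk).trans (hweight _ 0)
    | succ j ihj =>
      intro hj
      refine weighted_gronwall_step hL (hs.step_pos j) (ht.step_pos k) (hLs j) ?_ (hd k j)
        (hW k (j + 1)) (hW (k + 1) j) (hsub k j) ?_ ?_ (hsuper k j)
      · have := ht.nonneg (k + 1)
        have := hs.nonneg j
        gcongr
        linarith
      · exact (ihk (by lia) (j + 1) hj).trans_eq (by ring_nf)
      · exact (ihj (by lia)).trans_eq (by ring_nf)

lemma two_mul_mul_le_add_sqrt {M r u T D : ℝ} (hM : 0 ≤ M) (hr : 0 ≤ r) (hu : u ≤ M)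
    (hT : r ^ 2 ≤ T) (hD : 0 ≤ D) : 2 * r * u ≤ 2 * M * √T + D :=
  calc 2 * r * u ≤ 2 * r * M := by gcongr
    _ = 2 * M * r := by ring
    _ ≤ 2 * M * √T := by gcongr; exact Real.le_sqrt_of_sq_le hT
    _ ≤ 2 * M * √T + D := le_add_of_nonneg_right hD

lemma kobayashi_supersolution {t s : ℕ → ℝ} (ht : IsPartition t) (hs : IsPartition s) {ε M : ℝ}
    (htε : ∀ k, t (k + 1) - t k ≤ ε) (hsε : ∀ j, s (j + 1) - s j ≤ ε) (hM : 0 ≤ M) (k j : ℕ) :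
    (s (j + 1) - s j) * (M * √((t k - s (j + 1)) ^ 2 + ε * (t k + s (j + 1)))) +
      (t (k + 1) - t k) * (M * √((t (k + 1) - s j) ^ 2 + ε * (t (k + 1) + s j))) ≤
    ((s (j + 1) - s j) + (t (k + 1) - t k)) *
      (M * √((t (k + 1) - s (j + 1)) ^ 2 + ε * (t (k + 1) + s (j + 1)))) := by
  have hsum : (s (j + 1) - s j) + (t (k + 1) - t k) ≤ t (k + 1) + s (j + 1) := by
    linarith [ht.nonneg k, hs.nonneg j]
  have hstep := mul_le_mul_of_nonneg_left (kobayashi_sqrt_step (D := t (k + 1) - s (j + 1))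
    (hs.step_pos j).le (ht.step_pos k).le (hsε j) (htε k) hsum) hM
  rw [show t (k + 1) - s (j + 1) - (t (k + 1) - t k) = t k - s (j + 1) by ring,
    show t (k + 1) + s (j + 1) - (t (k + 1) - t k) = t k + s (j + 1) by ring,
    show t (k + 1) - s (j + 1) + (s (j + 1) - s j) = t (k + 1) - s j by ring,
    show t (k + 1) + s (j + 1) - (s (j + 1) - s j) = t (k + 1) + s j by ring] at hstep
  linarith

end DoubleIndex

section Comparison

variable {X : Type*} [MetricSpace X] {φ : X → EReal} {C L : ℝ} {x₀ : X} {p q : ℕ → ℝ}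
  {x y : ℕ → X}

/-- The two discrete variational inequalities, each tested with the next iterate of the other
solution and weighted by the time step of the other one: the potential differences cancel. -/
lemma IsDiscreteSolution.two_solution_evi (hx : IsDiscreteSolution φ x₀ p x)
    (hy : IsDiscreteSolution φ x₀ q y) (S : EVISetting φ C L) (hx₀ : x₀ ∈ dom φ)
    (hp : IsPartition p) (hq : IsPartition q) (k j : ℕ) :
    ((q (j + 1) - q j) + (p (k + 1) - p k)) * dist (x (k + 1)) (y (j + 1)) ^ 2 ≤
      (q (j + 1) - q j) * dist (x k) (y (j + 1)) ^ 2 +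
      (p (k + 1) - p k) * dist (x (k + 1)) (y j) ^ 2 +
      2 * C * ((p (k + 1) - p k) * (q (j + 1) - q j)) *
        ((val φ (x k) - val φ (x (k + 1))) + (val φ (y j) - val φ (y (j + 1)))) +
      2 * L * ((p (k + 1) - p k) * (q (j + 1) - q j)) * dist (x (k + 1)) (y (j + 1)) ^ 2 := by
  have hxy := hx.evi S hx₀ hp k (hy.mem_dom S.ne_bot hx₀ (j + 1))
  have hyx := hy.evi S hx₀ hq j (hx.mem_dom S.ne_bot hx₀ (k + 1))
  rw [dist_comm (y (j + 1)), dist_comm (y j)] at hyx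
  have hxy' := mul_le_mul_of_nonneg_left hxy (hq.step_pos j).le
  have hyx' := mul_le_mul_of_nonneg_left hyx (hp.step_pos k).le
  linarith

lemma IsDiscreteSolution.sq_dist_le_kobayashi (hx : IsDiscreteSolution φ x₀ p x)
    (hy : IsDiscreteSolution φ x₀ q y) (S : EVISetting φ C L) (hx₀ : x₀ ∈ dom φ)
    (hp : IsPartition p) (hq : IsPartition q) {ε M : ℝ} (hLε : 4 * L * ε ≤ 1)
    (hpε : ∀ k, p (k + 1) - p k ≤ ε) (hqε : ∀ k, q (k + 1) - q k ≤ ε) {k j : ℕ}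
    (hxM : ∀ i ≤ k, val φ x₀ - val φ (x i) ≤ M) (hyM : ∀ i ≤ j, val φ x₀ - val φ (y i) ≤ M) :
    dist (x k) (y j) ^ 2 ≤ Real.exp (4 * L * (p k + q j)) *
      (2 * M * √((p k - q j) ^ 2 + ε * (p k + q j)) + 4 * C * ε * M) := by
  have hC := S.C_nonneg
  have hL := S.L_nonneg
  have hε : 0 ≤ ε := hp.nonneg_of_step_le hpε
  have hM : 0 ≤ M := by simpa [hx.1] using hxM 0 k.zero_le
  have hx_drop (i : ℕ) := sub_nonneg.2 (hx.val_le S.ne_bot hx₀ hp i)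
  have hy_drop (i : ℕ) := sub_nonneg.2 (hy.val_le S.ne_bot hx₀ hq i)
  have hx_succ (i : ℕ) := sub_nonneg.2 (hx.val_succ_le S.ne_bot hx₀ hp i)
  have hy_succ (i : ℕ) := sub_nonneg.2 (hy.val_succ_le S.ne_bot hx₀ hq i)
  let kob (i l : ℕ) : ℝ := 2 * M * √((p i - q l) ^ 2 + ε * (p i + q l))
  let defect (i l : ℕ) : ℝ :=
    2 * C * ε * ((val φ x₀ - val φ (x i)) + (val φ x₀ - val φ (y l)))
  have hdefect (i l : ℕ) : 0 ≤ defect i l :=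
    mul_nonneg (by positivity) (add_nonneg (hx_drop i) (hy_drop l))
  have hmain := double_index_comparison (a := fun i l => dist (x i) (y l) ^ 2) (K := k) (J := j)
    (W := fun i l => kob i l + defect i l) hp hq hL
    (fun l => le_trans (by gcongr; exact hqε l) hLε)
    (fun i l => mul_nonneg (mul_nonneg (mul_nonneg two_pos.le hC)
      (mul_nonneg (hp.step_pos i).le (hq.step_pos l).le)) (add_nonneg (hx_succ i) (hy_succ l)))
    (fun i l => add_nonneg (by positivity) (hdefect i l))
    (fun i hi => ?_) (fun l hl => ?_)
    (hx.two_solution_evi hy S hx₀ hp hq) (fun i l => ?_) k le_rfl j le_rfl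
  · refine hmain.trans (mul_le_mul_of_nonneg_left ?_ (Real.exp_nonneg _))
    have : defect k j ≤ 2 * C * ε * (M + M) :=
      mul_le_mul_of_nonneg_left (add_le_add (hxM k le_rfl) (hyM j le_rfl)) (by positivity)
    linarith
  · have h := hx.sq_dist_start_le S.ne_bot hx₀ hp i
    simp only [hy.1, dist_comm (x i)]
    refine h.trans (two_mul_mul_le_add_sqrt hM (hp.nonneg i) (hxM i hi) ?_ (hdefect i 0))
    rw [hq.1, sub_zero, add_zero]
    exact le_add_of_nonneg_right (mul_nonneg hε (hp.nonneg i))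
  · have h := hy.sq_dist_start_le S.ne_bot hx₀ hq l
    simp only [hx.1]
    refine h.trans (two_mul_mul_le_add_sqrt hM (hq.nonneg l) (hyM l hl) ?_ (hdefect 0 l))
    rw [hp.1, zero_sub, neg_sq, zero_add]
    exact le_add_of_nonneg_right (mul_nonneg hε (hq.nonneg l))
  · have hkob := kobayashi_supersolution hp hq hpε hqε (mul_nonneg two_pos.le hM) i l
    have hx_err := mul_nonneg (mul_nonneg (mul_nonneg hC (hq.step_pos l).le) (hx_succ i))
      (sub_nonneg.2 (hpε i))
    have hy_err := mul_nonneg (mul_nonneg (mul_nonneg hC (hp.step_pos i).le) (hy_succ l))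
      (sub_nonneg.2 (hqε l))
    simp only [kob, defect]
    linarith

lemma EVISetting.exists_comparison (S : EVISetting φ C L) (hx₀ : x₀ ∈ dom φ) (T : ℝ) :
    ∃ ε₀ > 0, ∃ M, ∀ ε ≤ ε₀, ∀ p x q y, IsPartition p → IsDiscreteSolution φ x₀ p x →
      IsPartition q → IsDiscreteSolution φ x₀ q y →
      (∀ k, p (k + 1) - p k ≤ ε) → (∀ k, q (k + 1) - q k ≤ ε) → ∀ k j, p k ≤ T → q j ≤ T →
      |p k - q j| ≤ ε → dist (x k) (y j) ^ 2 ≤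
        Real.exp (8 * L * T) * (2 * M * √(ε ^ 2 + ε * (2 * T)) + 4 * C * ε * M) := by
  obtain ⟨ε₁, hε₁, M, hM, hdrop⟩ := S.exists_drop_bound hx₀ T
  have hC := S.C_nonneg
  have hL := S.L_nonneg
  refine ⟨min ε₁ (1 / (4 * (L + 1))), lt_min hε₁ (by positivity), M, ?_⟩
  intro ε hε p x q y hp hx hq hy hpε hqε k j hk hj hpq
  have hε0 : 0 ≤ ε := hp.nonneg_of_step_le hpε
  have hεε₁ : ε ≤ ε₁ := hε.trans (min_le_left _ _)
  have hLε : 4 * L * ε ≤ 1 := by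
    have h := hε.trans (min_le_right _ _)
    rw [le_div_iff₀ (by positivity)] at h
    linarith
  refine (hx.sq_dist_le_kobayashi hy S hx₀ hp hq hLε hpε hqε
    (fun i hi => hdrop p x hp hx (fun k => (hpε k).trans hεε₁) i ((hp.monotone hi).trans hk))
    (fun i hi => hdrop q y hq hy (fun k => (hqε k).trans hεε₁) i
      ((hq.monotone hi).trans hj))).trans ?_
  have hsq : (p k - q j) ^ 2 ≤ ε ^ 2 := sq_le_sq' (abs_le.1 hpq).1 (abs_le.1 hpq).2
  gcongr ?_ * (2 * M * √(?_ + ε * ?_) + 4 * C * ε * M)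
  · exact Real.exp_le_exp.2 (by nlinarith)
  · linarith

end Comparison

/-! ### Convergence to gradient curves -/

section NodeIndex

/-- The index of the node of the partition `p` at which `interpolate p x t` evaluates `x`, that is,
the first one with `t ≤ p k`. -/
noncomputable def nodeIndex (p : ℕ → ℝ) (t : ℝ≥0) : ℕ := sInf {k : ℕ | (t : ℝ) ≤ p k}

variable {p : ℕ → ℝ}

lemma IsPartition.le_node (hp : IsPartition p) (t : ℝ≥0) : (t : ℝ) ≤ p (nodeIndex p t) :=
  Nat.sInf_mem (hp.2.2.eventually_ge_atTop (t : ℝ)).exists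

lemma IsPartition.node_le (hp : IsPartition p) {ε : ℝ} (hε : ∀ k, p (k + 1) - p k ≤ ε)
    (t : ℝ≥0) : p (nodeIndex p t) ≤ t + ε := by
  have hε0 := hp.nonneg_of_step_le hε
  rcases hn : nodeIndex p t with _ | k
  · rw [hp.1]
    positivity
  · have hlt : k < nodeIndex p t := hn ▸ k.lt_succ_self
    have hk : p k < t := not_le.1 (Nat.notMem_of_lt_sInf hlt)
    linarith [hε k]

lemma IsPartition.nodeIndex_mono (hp : IsPartition p) : Monotone (nodeIndex p) := fun _ t hst =>
  Nat.sInf_le ((NNReal.coe_le_coe.2 hst).trans (hp.le_node t))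

lemma IsPartition.nodeIndex_zero (hp : IsPartition p) : nodeIndex p 0 = 0 :=
  Nat.sInf_eq_zero.2 (Or.inl (by simp [hp.1]))

lemma IsPartition.abs_node_sub_node_le {q : ℕ → ℝ} (hp : IsPartition p) (hq : IsPartition q)
    {ε : ℝ} (hpε : ∀ k, p (k + 1) - p k ≤ ε) (hqε : ∀ k, q (k + 1) - q k ≤ ε) (t : ℝ≥0) :
    |p (nodeIndex p t) - q (nodeIndex q t)| ≤ ε :=
  abs_sub_le_iff.2 ⟨by linarith [hp.node_le hpε t, hq.le_node t],
    by linarith [hq.node_le hqε t, hp.le_node t]⟩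

lemma tendsto_node {p : ℕ → ℕ → ℝ} {ε : ℕ → ℝ} (hp : ∀ i, IsPartition (p i))
    (hpε : ∀ i k, p i (k + 1) - p i k ≤ ε i) (hε : Tendsto ε atTop (𝓝 0)) (t : ℝ≥0) :
    Tendsto (fun i => p i (nodeIndex (p i) t)) atTop (𝓝 t) :=
  tendsto_of_tendsto_of_tendsto_of_le_of_le tendsto_const_nhds
    (by simpa only [add_zero] using hε.const_add (t : ℝ)) (fun i => (hp i).le_node t)
    fun i => (hp i).node_le (hpε i) t

end NodeIndex

section GradientCurve

variable {X : Type*} [MetricSpace X] {φ : X → EReal} {C L : ℝ} {x₀ : X} {ξ : ℝ≥0 → X}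

lemma IsGradientCurve.exists_approximation (hξ : IsGradientCurve φ x₀ ξ) :
    ∃ (p : ℕ → ℕ → ℝ) (x : ℕ → ℕ → X) (ε : ℕ → ℝ), (∀ i, IsPartition (p i)) ∧
      (∀ i, IsDiscreteSolution φ x₀ (p i) (x i)) ∧ (∀ i k, p i (k + 1) - p i k ≤ ε i) ∧
      Tendsto ε atTop (𝓝 0) ∧
      ∀ t, Tendsto (fun i => x i (nodeIndex (p i) t)) atTop (𝓝 (ξ t)) := by
  obtain ⟨p, x, hp, hmesh, hx, hlim⟩ := hξ
  obtain ⟨N, hN⟩ := eventually_atTop.1 (hmesh.eventually_lt_const ENNReal.zero_lt_top)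
  refine ⟨fun i => p (i + N), fun i => x (i + N), fun i => (mesh (p (i + N))).toReal,
    fun i => hp _, fun i => hx _, fun i k => ?_, ?_,
    fun t => (tendsto_add_atTop_iff_nat N).2 (hlim t)⟩
  · exact (ENNReal.ofReal_le_iff_le_toReal (hN _ (Nat.le_add_left _ _)).ne).1
      (le_iSup (fun k => ENNReal.ofReal (p (i + N) (k + 1) - p (i + N) k)) k)
  · exact (ENNReal.tendsto_toReal ENNReal.zero_ne_top).comp ((tendsto_add_atTop_iff_nat N).2 hmesh)

lemma IsGradientCurve.apply_zero (hξ : IsGradientCurve φ x₀ ξ) : ξ 0 = x₀ := by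
  obtain ⟨p, x, -, hp, hx, -, -, hlim⟩ := hξ.exists_approximation
  refine tendsto_nhds_unique (hlim 0) ?_
  simp only [(hp _).nodeIndex_zero, (hx _).1, tendsto_const_nhds]

lemma IsGradientCurve.mem_dom_and_val_le (hξ : IsGradientCurve φ x₀ ξ) (hbot : ∀ x, φ x ≠ ⊥)
    (hlsc : LowerSemicontinuous φ) (hx₀ : x₀ ∈ dom φ) (t : ℝ≥0) :
    ξ t ∈ dom φ ∧ val φ (ξ t) ≤ val φ x₀ - dist x₀ (ξ t) ^ 2 / (2 * t) := by
  rcases eq_zero_or_pos t with rfl | ht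
  · simp [hξ.apply_zero, hx₀]
  obtain ⟨p, x, ε, hp, hx, hpε, hε, hlim⟩ := hξ.exists_approximation
  refine mem_dom_and_val_le_of_tendsto hbot hlsc (hlim t)
    (Eventually.of_forall fun i => (hx i).mem_dom hbot hx₀ _)
    (Eventually.of_forall fun i => ?_)
    (tendsto_const_nhds.sub (((tendsto_const_nhds.dist (hlim t)).pow 2).div
      ((tendsto_node hp hpε hε t).const_mul 2) (by positivity)))
  set n := nodeIndex (p i) t
  have hdist := (hx i).sq_dist_start_le hbot hx₀ (hp i) n
  have hquot : dist x₀ (x i n) ^ 2 / (2 * p i n) ≤ val φ x₀ - val φ (x i n) :=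
    div_le_of_le_mul₀ (mul_nonneg two_pos.le ((hp i).nonneg n))
      (sub_nonneg.2 ((hx i).val_le hbot hx₀ (hp i) n)) (by linarith)
  exact le_sub_comm.1 hquot

lemma IsGradientCurve.mem_dom (hξ : IsGradientCurve φ x₀ ξ) (hbot : ∀ x, φ x ≠ ⊥)
    (hlsc : LowerSemicontinuous φ) (hx₀ : x₀ ∈ dom φ) (t : ℝ≥0) : ξ t ∈ dom φ :=
  (hξ.mem_dom_and_val_le hbot hlsc hx₀ t).1

lemma IsGradientCurve.sq_dist_le (hξ : IsGradientCurve φ x₀ ξ) (hbot : ∀ x, φ x ≠ ⊥)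
    (hlsc : LowerSemicontinuous φ) (hx₀ : x₀ ∈ dom φ) (t : ℝ≥0) :
    dist x₀ (ξ t) ^ 2 ≤ 2 * t * (val φ x₀ - val φ (ξ t)) := by
  rcases eq_zero_or_pos t with rfl | ht
  · simp [hξ.apply_zero]
  have h := le_sub_comm.1 (hξ.mem_dom_and_val_le hbot hlsc hx₀ t).2
  rw [div_le_iff₀ (by positivity)] at h
  linarith

namespace EVISetting

lemma tendsto_dist_interpolate (S : EVISetting φ C L) (hx₀ : x₀ ∈ dom φ) {ι : Type*}
    {l : Filter ι} {p q : ι → ℕ → ℝ} {x y : ι → ℕ → X} {ε : ι → ℝ} (hp : ∀ i, IsPartition (p i))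
    (hq : ∀ i, IsPartition (q i)) (hx : ∀ i, IsDiscreteSolution φ x₀ (p i) (x i))
    (hy : ∀ i, IsDiscreteSolution φ x₀ (q i) (y i)) (hε : Tendsto ε l (𝓝 0))
    (hpε : ∀ i k, p i (k + 1) - p i k ≤ ε i) (hqε : ∀ i k, q i (k + 1) - q i k ≤ ε i) (t : ℝ≥0) :
    Tendsto (fun i => dist (x i (nodeIndex (p i) t)) (y i (nodeIndex (q i) t))) l (𝓝 0) := by
  obtain ⟨ε₀, hε₀, M, hcompare⟩ := S.exists_comparison hx₀ (t + 1)
  let ω (e : ℝ) : ℝ := Real.exp (8 * L * (t + 1)) *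
    (2 * M * √(e ^ 2 + e * (2 * (t + 1))) + 4 * C * e * M)
  have hω : Tendsto (fun i => √(ω (ε i))) l (𝓝 0) := by
    have hcont : Continuous fun e => √(ω e) := by fun_prop
    simpa [ω, Function.comp_def] using (hcont.tendsto 0).comp hε
  refine squeeze_zero' (Eventually.of_forall fun _ => dist_nonneg) ?_ hω
  filter_upwards [hε.eventually_lt_const hε₀, hε.eventually_lt_const one_pos] with i hi hi1
  refine Real.le_sqrt_of_sq_le (hcompare (ε i) hi.le _ _ _ _ (hp i) (hx i) (hq i) (hy i) (hpε i)
    (hqε i) _ _ ?_ ?_ ((hp i).abs_node_sub_node_le (hq i) (hpε i) (hqε i) t))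
  · exact ((hp i).node_le (hpε i) t).trans (by gcongr)
  · exact ((hq i).node_le (hqε i) t).trans (by gcongr)

lemma gradientCurve_unique (S : EVISetting φ C L) (hx₀ : x₀ ∈ dom φ) {ζ : ℝ≥0 → X}
    (hξ : IsGradientCurve φ x₀ ξ) (hζ : IsGradientCurve φ x₀ ζ) : ξ = ζ := by
  obtain ⟨p, x, ε, hp, hx, hpε, hε, hxξ⟩ := hξ.exists_approximation
  obtain ⟨q, y, δ, hq, hy, hqδ, hδ, hyζ⟩ := hζ.exists_approximation
  have hmax : Tendsto (fun i => max (ε i) (δ i)) atTop (𝓝 0) := by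
    simpa only [max_self] using hε.max hδ
  funext t
  refine dist_eq_zero.1 (tendsto_nhds_unique ((hxξ t).dist (hyζ t)) ?_)
  exact S.tendsto_dist_interpolate hx₀ hp hq hx hy hmax
    (fun i k => (hpε i k).trans (le_max_left _ _))
    (fun i k => (hqδ i k).trans (le_max_right _ _)) t

lemma cauchySeq_interpolate (S : EVISetting φ C L) (hx₀ : x₀ ∈ dom φ) {p : ℕ → ℕ → ℝ}
    {x : ℕ → ℕ → X} {ε : ℕ → ℝ} (hp : ∀ i, IsPartition (p i))
    (hx : ∀ i, IsDiscreteSolution φ x₀ (p i) (x i)) (hε : Tendsto ε atTop (𝓝 0))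
    (hpε : ∀ i k, p i (k + 1) - p i k ≤ ε i) (t : ℝ≥0) :
    CauchySeq fun i => x i (nodeIndex (p i) t) := by
  rw [cauchySeq_iff_tendsto_dist_atTop_0]
  have hmax : Tendsto (fun n : ℕ × ℕ => max (ε n.1) (ε n.2)) atTop (𝓝 0) := by
    rw [← prod_atTop_atTop_eq]
    simpa only [max_self, Function.comp_apply] using (hε.comp tendsto_fst).max (hε.comp tendsto_snd)
  exact S.tendsto_dist_interpolate (p := fun n => p n.1) (q := fun n => p n.2)
    (x := fun n => x n.1) (y := fun n => x n.2) hx₀ (fun n => hp n.1) (fun n => hp n.2)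
    (fun n => hx n.1) (fun n => hx n.2) hmax
    (fun n k => (hpε n.1 k).trans (le_max_left _ _))
    (fun n k => (hpε n.2 k).trans (le_max_right _ _)) t

end EVISetting

lemma exists_discreteSolution (hbot : ∀ x, φ x ≠ ⊥) (hx₀ : x₀ ∈ dom φ) {τs : ℝ}
    (hprox : ∀ x ∈ dom φ, ∀ τ, 0 < τ → τ < τs → (proxSet φ τ x).Nonempty) {p : ℕ → ℝ}
    (hp : IsPartition p) (hpτ : ∀ k, p (k + 1) - p k < τs) : ∃ x, IsDiscreteSolution φ x₀ p x := by
  choose! J hJ using hprox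
  let x : ℕ → X := fun n => Nat.rec x₀ (fun k z => J z (p (k + 1) - p k)) n
  have hprox_x {k : ℕ} (hk : x k ∈ dom φ) : x (k + 1) ∈ proxSet φ (p (k + 1) - p k) (x k) :=
    hJ _ hk _ (hp.step_pos k) (hpτ k)
  have hx (n : ℕ) : x n ∈ dom φ := by
    induction n with
    | zero => exact hx₀
    | succ k ih => exact ((mem_proxSet_iff hbot ⟨_, ih⟩).1 (hprox_x ih)).1
  exact ⟨x, rfl, fun k => hprox_x (hx k)⟩

namespace EVISetting

lemma exists_gradientCurve [CompleteSpace X] (S : EVISetting φ C L) (hx₀ : x₀ ∈ dom φ) :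
    ∃ ξ, IsGradientCurve φ x₀ ξ := by
  obtain ⟨τs, hτs, hprox⟩ := S.exists_prox
  obtain ⟨h, -, hh, hh0⟩ := exists_seq_strictAnti_tendsto' hτs
  let p (i k : ℕ) : ℝ := k * h i
  have hp (i : ℕ) : IsPartition (p i) := isPartition_natCast_mul (hh i).1
  have hstep (i k : ℕ) : p i (k + 1) - p i k = h i := by simp only [p]; push_cast; ring
  choose x hx using fun i =>
    exists_discreteSolution S.ne_bot hx₀ hprox (hp i) fun k => (hstep i k).trans_lt (hh i).2
  choose ξ hξ using fun t => cauchySeq_tendsto_of_complete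
    (S.cauchySeq_interpolate hx₀ hp hx hh0 (fun i k => (hstep i k).le) t)
  refine ⟨ξ, p, x, hp, ?_, hx, hξ⟩
  simpa [mesh, hstep] using ENNReal.tendsto_ofReal hh0

lemma existsUnique_gradientCurve [CompleteSpace X] (S : EVISetting φ C L) (hx₀ : x₀ ∈ dom φ) :
    ∃! ξ, IsGradientCurve φ x₀ ξ := by
  obtain ⟨ξ, hξ⟩ := S.exists_gradientCurve hx₀
  exact ⟨ξ, hξ, fun ζ hζ => S.gradientCurve_unique hx₀ hζ hξ⟩

lemma exists_sq_dist_gradientCurve_le (S : EVISetting φ C L) (hx₀ : x₀ ∈ dom φ)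
    (hξ : IsGradientCurve φ x₀ ξ) (T : ℝ) :
    ∃ M, ∀ r s : ℝ≥0, r ≤ s → s ≤ T → dist (ξ r) (ξ s) ^ 2 ≤ 2 * (s - r) * M := by
  obtain ⟨p, x, ε, hp, hx, hpε, hε, hlim⟩ := hξ.exists_approximation
  obtain ⟨ε₀, hε₀, M, -, hdrop⟩ := S.exists_drop_bound hx₀ (T + 1)
  refine ⟨M, fun r s hrs hs => ?_⟩
  refine le_of_tendsto_of_tendsto (((hlim r).dist (hlim s)).pow 2)
    ((((tendsto_node hp hpε hε s).sub (tendsto_node hp hpε hε r)).const_mul 2).mul_const M) ?_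
  filter_upwards [hε.eventually_lt_const hε₀, hε.eventually_lt_const one_pos] with i hi hi1
  have hidx := (hp i).nodeIndex_mono hrs
  have hnode := sub_nonneg.2 ((hp i).monotone hidx)
  have hvalr := (hx i).val_le S.ne_bot hx₀ (hp i) (nodeIndex (p i) r)
  have hvals := hdrop _ _ (hp i) (hx i) (fun k => (hpε i k).trans hi.le) (nodeIndex (p i) s)
    (((hp i).node_le (hpε i) s).trans (by gcongr))
  exact ((hx i).sq_dist_le S.ne_bot hx₀ (hp i) hidx).trans (by gcongr; linarith)

lemma continuous_gradientCurve (S : EVISetting φ C L) (hx₀ : x₀ ∈ dom φ)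
    (hξ : IsGradientCurve φ x₀ ξ) : Continuous ξ := by
  rw [continuous_iff_continuousAt]
  intro t
  obtain ⟨M, hM⟩ := S.exists_sq_dist_gradientCurve_le hx₀ hξ (t + 1)
  have hholder (s : ℝ≥0) (hs : (s : ℝ) ≤ t + 1) : dist (ξ s) (ξ t) ≤ √(2 * dist s t * M) := by
    refine Real.le_sqrt_of_sq_le ?_
    rw [NNReal.dist_eq]
    rcases le_total s t with hst | hts
    · rw [abs_sub_comm, abs_of_nonneg (sub_nonneg.2 (NNReal.coe_le_coe.2 hst))]
      exact hM s t hst (by linarith)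
    · rw [abs_of_nonneg (sub_nonneg.2 (NNReal.coe_le_coe.2 hts)), dist_comm]
      exact hM t s hts hs
  have hlim : Tendsto (fun s : ℝ≥0 => √(2 * dist s t * M)) (𝓝 t) (𝓝 0) := by
    have hcont : Continuous fun s : ℝ≥0 => √(2 * dist s t * M) := by fun_prop
    simpa only [dist_self, mul_zero, zero_mul, Real.sqrt_zero] using hcont.tendsto t
  rw [ContinuousAt, tendsto_iff_dist_tendsto_zero]
  refine squeeze_zero' (Eventually.of_forall fun _ => dist_nonneg) ?_ hlim
  filter_upwards [gt_mem_nhds (lt_add_one t)] with s hs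
  exact hholder s (by exact_mod_cast hs.le)

end EVISetting

end GradientCurve

/-! ### Stationary points -/

section Stationary

variable {X : Type*} [MetricSpace X] {φ : X → EReal} {C L : ℝ} {x₀ : X}

lemma IsDiscreteSolution.integrated_evi {p : ℕ → ℝ} {x : ℕ → X}
    (hx : IsDiscreteSolution φ x₀ p x) (S : EVISetting φ C L) (hx₀ : x₀ ∈ dom φ)
    (hp : IsPartition p) {y : X} (hy : y ∈ dom φ) {ε Q : ℝ} (hε : ∀ k, p (k + 1) - p k ≤ ε) {n : ℕ}
    (hQ : ∀ k ≤ n, dist (x k) y ^ 2 ≤ Q) :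
    dist (x n) y ^ 2 ≤ dist x₀ y ^ 2 + 2 * C * ε * (val φ x₀ - val φ (x n))
      + p n * (2 * (val φ y - val φ (x n)) + L * Q) := by
  suffices key : ∀ k ≤ n, dist (x k) y ^ 2 ≤ dist x₀ y ^ 2 +
      2 * C * ε * (val φ x₀ - val φ (x k)) + p k * (2 * (val φ y - val φ (x n)) + L * Q) from
    key n le_rfl
  intro k
  induction k with
  | zero => simp [hx.1, hp.1]
  | succ k ih =>
    intro hk
    have hevi := hx.evi S hx₀ hp k hy
    have hτ := (hp.step_pos k).le
    have hdefect := mul_nonneg (mul_nonneg S.C_nonneg (sub_nonneg.2 (hε k)))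
      (sub_nonneg.2 (hx.val_succ_le S.ne_bot hx₀ hp k))
    have hval : val φ (x n) ≤ val φ (x (k + 1)) := hx.val_antitone S.ne_bot hx₀ hp hk
    have hval' := mul_nonneg hτ (sub_nonneg.2 hval)
    have hquad := mul_nonneg (mul_nonneg hτ S.L_nonneg) (sub_nonneg.2 (hQ (k + 1) hk))
    linarith [ih (by lia)]

lemma IsDiscreteSolution.val_le_of_drop_le {p : ℕ → ℝ} {x : ℕ → X}
    (hx : IsDiscreteSolution φ x₀ p x) (S : EVISetting φ C L) (hx₀ : x₀ ∈ dom φ)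
    (hp : IsPartition p) {y : X} (hy : y ∈ dom φ) {ε M : ℝ} (hε : ∀ k, p (k + 1) - p k ≤ ε) {n : ℕ}
    (hn : 0 < p n) (hM : val φ x₀ - val φ (x n) ≤ M) :
    val φ (x n) ≤ val φ y + L / 2 * (dist x₀ y + √(2 * p n * M)) ^ 2 +
      (dist x₀ y ^ 2 - dist (x n) y ^ 2 + 2 * C * ε * M) / (2 * p n) := by
  have hnear (k : ℕ) (hk : k ≤ n) : dist x₀ (x k) ≤ √(2 * p n * M) := by
    refine Real.le_sqrt_of_sq_le ((hx.sq_dist_start_le S.ne_bot hx₀ hp k).trans ?_)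
    have hdrop : val φ x₀ - val φ (x k) ≤ M :=
      (sub_le_sub_left (hx.val_antitone S.ne_bot hx₀ hp hk) _).trans hM
    exact mul_le_mul (mul_le_mul_of_nonneg_left (hp.monotone hk) two_pos.le) hdrop
      (sub_nonneg.2 (hx.val_le S.ne_bot hx₀ hp k)) (by positivity)
  have hint := hx.integrated_evi S hx₀ hp hy hε (n := n)
    (Q := (dist x₀ y + √(2 * p n * M)) ^ 2) fun k hk => by
      gcongr
      linarith [dist_triangle_left (x k) y x₀, hnear k hk]
  have hdefect := mul_le_mul_of_nonneg_left hM
    (mul_nonneg (mul_nonneg two_pos.le S.C_nonneg) (hp.nonneg_of_step_le hε))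
  rw [← sub_le_iff_le_add', le_div_iff₀ (by positivity)]
  linarith

lemma IsGradientCurve.exists_val_le {ξ : ℝ≥0 → X} (hξ : IsGradientCurve φ x₀ ξ)
    (S : EVISetting φ C L) (hx₀ : x₀ ∈ dom φ) (T : ℝ) :
    ∃ M, ∀ t : ℝ≥0, 0 < t → t ≤ T → ∀ y ∈ dom φ, val φ (ξ t) ≤ val φ y +
      L / 2 * (dist x₀ y + √(2 * t * M)) ^ 2 + (dist x₀ y ^ 2 - dist (ξ t) y ^ 2) / (2 * t) := by
  obtain ⟨p, x, ε, hp, hx, hpε, hε, hlim⟩ := hξ.exists_approximation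
  obtain ⟨ε₀, hε₀, M, -, hdrop⟩ := S.exists_drop_bound hx₀ (T + 1)
  refine ⟨M, fun t ht htT y hy => ?_⟩
  have hnode := tendsto_node hp hpε hε t
  refine (mem_dom_and_val_le_of_tendsto S.ne_bot S.lowerSemicontinuous (hlim t)
    (b := fun i => val φ y + L / 2 * (dist x₀ y + √(2 * p i (nodeIndex (p i) t) * M)) ^ 2 +
      (dist x₀ y ^ 2 - dist (x i (nodeIndex (p i) t)) y ^ 2 + 2 * C * ε i * M) /
        (2 * p i (nodeIndex (p i) t)))
    (Eventually.of_forall fun i => (hx i).mem_dom S.ne_bot hx₀ _) ?_ ?_).2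
  · filter_upwards [hε.eventually_lt_const hε₀, hε.eventually_lt_const one_pos] with i hi hi1
    refine (hx i).val_le_of_drop_le S hx₀ (hp i) hy (hpε i)
      ((NNReal.coe_pos.2 ht).trans_le ((hp i).le_node t)) ?_
    exact hdrop _ _ (hp i) (hx i) (fun k => (hpε i k).trans hi.le) _
      (((hp i).node_le (hpε i) t).trans (by gcongr))
  · have hquad := (((hnode.const_mul 2).mul_const M).sqrt.const_add (dist x₀ y)).pow 2
    have hquot := (((((hlim t).dist (tendsto_const_nhds (x := y))).pow 2).const_sub
      (dist x₀ y ^ 2)).add ((hε.const_mul (2 * C)).mul_const M)).div (hnode.const_mul 2)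
      (by positivity)
    simpa only [mul_zero, zero_mul, add_zero, Pi.div_apply] using
      ((hquad.const_mul (L / 2)).const_add (val φ y)).add hquot

lemma EVISetting.val_sub_le_of_stationary (S : EVISetting φ C L) (hx₀ : x₀ ∈ dom φ)
    {ξ : ℝ≥0 → X} (hξ : IsGradientCurve φ x₀ ξ) (hconst : ∀ t, 0 < t → ξ t = x₀) {y : X}
    (hy : y ∈ dom φ) : val φ x₀ - val φ y ≤ L / 2 * dist x₀ y ^ 2 := by
  obtain ⟨M, hM⟩ := hξ.exists_val_le S hx₀ 1
  have hcont : Continuous fun t : ℝ≥0 => val φ y + L / 2 * (dist x₀ y + √(2 * t * M)) ^ 2 := by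
    fun_prop
  have hlim : Tendsto (fun t : ℝ≥0 => val φ y + L / 2 * (dist x₀ y + √(2 * t * M)) ^ 2)
      (𝓝[>] 0) (𝓝 (val φ y + L / 2 * dist x₀ y ^ 2)) := by
    simpa using (hcont.tendsto 0).mono_left nhdsWithin_le_nhds
  refine sub_le_iff_le_add'.2 (ge_of_tendsto hlim ?_)
  filter_upwards [Ioc_mem_nhdsGT one_pos] with t ht
  simpa [hconst t ht.1] using hM t ht.1 (NNReal.coe_le_one.2 ht.2) y hy

lemma slope_quotient_eq (hbot : ∀ x, φ x ≠ ⊥) {x y : X} (hx : x ∈ dom φ) (hy : y ∈ dom φ)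
    (hxy : x ≠ y) : (max (φ x - φ y) 0).toENNReal / edist x y =
      ENNReal.ofReal (max (val φ x - val φ y) 0 / dist x y) := by
  have hmax : max (φ x - φ y) 0 = ((max (val φ x - val φ y) 0 : ℝ) : EReal) := by
    rw [EReal.coe_strictMono.monotone.map_max, EReal.coe_sub, coe_val hbot hx, coe_val hbot hy,
      EReal.coe_zero]
  rw [hmax, EReal.toENNReal_of_ne_top (EReal.coe_ne_top _), EReal.toReal_coe, edist_dist,
    ENNReal.ofReal_div_of_pos (dist_pos.2 hxy)]

lemma localSlope_eq_zero_of_val_sub_le (hbot : ∀ x, φ x ≠ ⊥) (hx₀ : x₀ ∈ dom φ) {c : ℝ}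
    (h : ∀ y ∈ dom φ, val φ x₀ - val φ y ≤ c * dist x₀ y ^ 2) : localSlope φ x₀ = 0 := by
  have hbound : ∀ᶠ y in 𝓝[≠] x₀, (max (φ x₀ - φ y) 0).toENNReal / edist x₀ y ≤
      ENNReal.ofReal (|c| * dist x₀ y) := by
    filter_upwards [self_mem_nhdsWithin] with y hy
    by_cases hyd : y ∈ dom φ
    · have hyx : x₀ ≠ y := Ne.symm hy
      rw [slope_quotient_eq hbot hx₀ hyd hyx]
      refine ENNReal.ofReal_le_ofReal ((div_le_iff₀ (dist_pos.2 hyx)).2 (max_le ?_ (by positivity)))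
      calc val φ x₀ - val φ y ≤ c * dist x₀ y ^ 2 := h y hyd
        _ ≤ |c| * dist x₀ y ^ 2 := by gcongr; exact le_abs_self c
        _ = |c| * dist x₀ y * dist x₀ y := by ring
    · rw [not_not.1 hyd, EReal.sub_top]
      simp
  have hcont : Continuous fun y => ENNReal.ofReal (|c| * dist x₀ y) :=
    ENNReal.continuous_ofReal.comp (by fun_prop)
  have hlim : Tendsto (fun y => ENNReal.ofReal (|c| * dist x₀ y)) (𝓝[≠] x₀) (𝓝 0) := by
    simpa using (hcont.tendsto x₀).mono_left nhdsWithin_le_nhds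
  rcases eq_or_neBot (𝓝[≠] x₀) with hisolated | hne
  · simp [localSlope, hisolated]
  · exact nonpos_iff_eq_zero.1 ((limsup_le_limsup hbound).trans_eq hlim.limsup_eq)

lemma IsMinGeodesic.dist_left {Y : Type*} {d : Y → Y → ℝ} {γ : ℝ → Y} {x y : Y}
    (hγ : IsMinGeodesic d γ x y) {s : ℝ} (hs : s ∈ Icc (0 : ℝ) 1) : d x (γ s) = s * d x y := by
  simpa [hγ.1, abs_of_nonneg hs.1] using hγ.2.2 0 ⟨le_rfl, zero_le_one⟩ s hs

lemma IsMinGeodesic.tendsto_left {γ : ℝ → X} {x y : X} (hγ : IsMinGeodesic dist γ x y) :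
    Tendsto γ (𝓝[>] 0) (𝓝 x) := by
  have hlim : Tendsto (fun s : ℝ => s * dist x y) (𝓝[>] 0) (𝓝 0) := by
    simpa using ((continuous_mul_const (dist x y)).tendsto 0).mono_left nhdsWithin_le_nhds
  rw [tendsto_iff_dist_tendsto_zero]
  refine hlim.congr' ?_
  filter_upwards [Ioc_mem_nhdsGT one_pos] with s hs
  rw [dist_comm (γ s), hγ.dist_left ⟨hs.1.le, hs.2⟩]

lemma IsMinGeodesic.left_ne {γ : ℝ → X} {x y : X} (hγ : IsMinGeodesic dist γ x y) (hxy : x ≠ y)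
    {s : ℝ} (hs : s ∈ Ioc (0 : ℝ) 1) : x ≠ γ s :=
  dist_pos.1 (hγ.dist_left ⟨hs.1.le, hs.2⟩ ▸ mul_pos hs.1 (dist_pos.2 hxy))

lemma IsLambdaConvex.val_sub_le_of_localSlope_lt {lam : ℝ} (hconv : IsLambdaConvex φ lam)
    (hbot : ∀ x, φ x ≠ ⊥) (hx₀ : x₀ ∈ dom φ) {c : ℝ} (h : localSlope φ x₀ < ENNReal.ofReal c)
    {y : X} (hy : y ∈ dom φ) :
    val φ x₀ - val φ y + lam / 2 * dist x₀ y ^ 2 ≤ c * dist x₀ y := by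
  rcases eq_or_ne x₀ y with rfl | hne
  · simp
  obtain ⟨γ, hγ, hγconv⟩ := hconv x₀ hx₀ y hy
  have hmem : ∀ᶠ s : ℝ in 𝓝[>] 0, s ∈ Ioc (0 : ℝ) 1 := Ioc_mem_nhdsGT one_pos
  have hγ_ne : Tendsto γ (𝓝[>] 0) (𝓝[≠] x₀) :=
    tendsto_nhdsWithin_iff.2 ⟨hγ.tendsto_left, hmem.mono fun s hs => (hγ.left_ne hne hs).symm⟩
  have hcont : Continuous fun s : ℝ =>
      val φ x₀ - val φ y + lam / 2 * (1 - s) * dist x₀ y ^ 2 := by fun_prop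
  have hlim : Tendsto (fun s : ℝ => val φ x₀ - val φ y + lam / 2 * (1 - s) * dist x₀ y ^ 2)
      (𝓝[>] 0) (𝓝 (val φ x₀ - val φ y + lam / 2 * dist x₀ y ^ 2)) := by
    simpa using (hcont.tendsto 0).mono_left nhdsWithin_le_nhds
  refine le_of_tendsto hlim ?_
  filter_upwards [hmem, hγ_ne.eventually (eventually_lt_of_limsup_lt h)] with s hs hslope
  have hs' : s ∈ Icc (0 : ℝ) 1 := ⟨hs.1.le, hs.2⟩
  have hval := val_le_of_le hbot (hγconv s hs')
  have hγs := hγ.left_ne hne hs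
  rw [slope_quotient_eq hbot hx₀ (mem_dom_of_le (hγconv s hs')) hγs,
    ENNReal.ofReal_lt_ofReal_iff_of_nonneg (by positivity), div_lt_iff₀ (dist_pos.2 hγs),
    hγ.dist_left hs'] at hslope
  refine le_of_mul_le_mul_left ?_ hs.1
  linarith [(le_max_left _ _).trans_lt hslope]

lemma IsLambdaConvex.val_sub_le_of_localSlope_eq_zero {lam : ℝ} (hconv : IsLambdaConvex φ lam)
    (hbot : ∀ x, φ x ≠ ⊥) (hx₀ : x₀ ∈ dom φ) (h : localSlope φ x₀ = 0) {y : X} (hy : y ∈ dom φ) :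
    val φ x₀ - val φ y ≤ -(lam / 2) * dist x₀ y ^ 2 := by
  have hlim : Tendsto (fun c : ℝ => c * dist x₀ y) (𝓝[>] 0) (𝓝 0) := by
    simpa using ((continuous_mul_const (dist x₀ y)).tendsto 0).mono_left nhdsWithin_le_nhds
  have hnonpos := ge_of_tendsto hlim <| by
    filter_upwards [self_mem_nhdsWithin] with c hc
    exact hconv.val_sub_le_of_localSlope_lt hbot hx₀ (h ▸ ENNReal.ofReal_pos.2 hc) hy
  linarith

lemma IsDiscreteSolution.eq_of_val_sub_le {p : ℕ → ℝ} {x : ℕ → X}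
    (hx : IsDiscreteSolution φ x₀ p x) (hbot : ∀ x, φ x ≠ ⊥) (hx₀ : x₀ ∈ dom φ)
    (hp : IsPartition p) {c : ℝ} (h : ∀ y ∈ dom φ, val φ x₀ - val φ y ≤ c * dist x₀ y ^ 2)
    (hc : ∀ k, 2 * c * (p (k + 1) - p k) < 1) (k : ℕ) : x k = x₀ := by
  induction k with
  | zero => exact hx.1
  | succ k ih =>
    have hstep := hx.sq_dist_succ_le hbot hx₀ hp k
    rw [ih] at hstep
    have hval := mul_le_mul_of_nonneg_left (h _ (hx.mem_dom hbot hx₀ (k + 1)))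
      (mul_nonneg two_pos.le (hp.step_pos k).le)
    by_contra hne
    have hpos : 0 < dist x₀ (x (k + 1)) ^ 2 := pow_pos (dist_pos.2 (Ne.symm hne)) 2
    linarith [mul_lt_mul_of_pos_right (hc k) hpos]

lemma IsGradientCurve.eq_of_val_sub_le {ξ : ℝ≥0 → X} (hξ : IsGradientCurve φ x₀ ξ)
    (hbot : ∀ x, φ x ≠ ⊥) (hx₀ : x₀ ∈ dom φ) {c : ℝ}
    (h : ∀ y ∈ dom φ, val φ x₀ - val φ y ≤ c * dist x₀ y ^ 2) (t : ℝ≥0) : ξ t = x₀ := by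
  obtain ⟨p, x, ε, hp, hx, hpε, hε, hlim⟩ := hξ.exists_approximation
  refine tendsto_nhds_unique (hlim t) (tendsto_const_nhds.congr' ?_)
  have hsmall : Tendsto (fun i => 2 * |c| * ε i) atTop (𝓝 0) := by
    simpa only [mul_zero] using hε.const_mul (2 * |c|)
  filter_upwards [hsmall.eventually_lt_const one_pos] with i hi
  refine ((hx i).eq_of_val_sub_le hbot hx₀ (hp i) h (fun k => hi.trans_le' ?_) _).symm
  have hτ := ((hp i).step_pos k).le
  calc 2 * c * (p i (k + 1) - p i k) ≤ 2 * |c| * (p i (k + 1) - p i k) := by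
        gcongr
        exact le_abs_self c
    _ ≤ 2 * |c| * ε i := by gcongr; exact hpε i k

lemma EVISetting.localSlope_eq_zero_iff (S : EVISetting φ C L) {lam : ℝ}
    (hconv : IsLambdaConvex φ lam) (hx₀ : x₀ ∈ dom φ) {ξ : ℝ≥0 → X}
    (hξ : IsGradientCurve φ x₀ ξ) : localSlope φ x₀ = 0 ↔ ∀ t, 0 < t → ξ t = x₀ :=
  ⟨fun h t _ => hξ.eq_of_val_sub_le S.ne_bot hx₀
    (fun _ => hconv.val_sub_le_of_localSlope_eq_zero S.ne_bot hx₀ h) t,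
  fun h => localSlope_eq_zero_of_val_sub_le S.ne_bot hx₀
    fun _ => S.val_sub_le_of_stationary hx₀ hξ h⟩

lemma gradientFlow_eq {ξ : ℝ≥0 → X} (hunique : ∃! ξ, IsGradientCurve φ x₀ ξ)
    (hξ : IsGradientCurve φ x₀ ξ) (t : ℝ≥0) : gradientFlow φ t x₀ = ξ t :=
  congrFun (hunique.unique (Classical.epsilon_spec ⟨ξ, hξ⟩) hξ) t

lemma EVISetting.gradientFlow_stationary_iff [CompleteSpace X] (S : EVISetting φ C L) {lam : ℝ}
    (hconv : IsLambdaConvex φ lam) (hx₀ : x₀ ∈ dom φ) :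
    (∃! ξ, IsGradientCurve φ x₀ ξ) ∧
      (localSlope φ x₀ = 0 ↔ ∀ t : ℝ≥0, 0 < t → gradientFlow φ t x₀ = x₀) := by
  have hunique := S.existsUnique_gradientCurve hx₀
  obtain ⟨ξ, hξ⟩ := hunique.exists
  simp only [gradientFlow_eq hunique hξ]
  exact ⟨hunique, S.localSlope_eq_zero_iff hconv hx₀ hξ⟩

end Stationary

/-! ### Trigonometric inequalities -/

lemma sin_add_le {A B : ℝ} (hA : A ∈ Icc 0 Real.pi) (hB : B ∈ Icc 0 Real.pi) :
    Real.sin (A + B) ≤ Real.sin A + Real.sin B := by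
  rw [Real.sin_add]
  exact add_le_add
    (mul_le_of_le_one_right (Real.sin_nonneg_of_mem_Icc hA) (Real.cos_le_one B))
    (mul_le_of_le_one_left (Real.sin_nonneg_of_mem_Icc hB) (Real.cos_le_one A))

lemma sinc_nonneg {a : ℝ} (ha : a ∈ Icc 0 Real.pi) : 0 ≤ Real.sinc a := by
  rw [Real.sinc_apply]
  split_ifs
  · exact zero_le_one
  · exact div_nonneg (Real.sin_nonneg_of_mem_Icc ha) ha.1

lemma half_le_sinc {a : ℝ} (ha : a ∈ Icc 0 (Real.pi / 2)) : 1 / 2 ≤ Real.sinc a := by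
  rcases ha.1.eq_or_lt with rfl | hpos
  · norm_num
  rw [Real.sinc_of_ne_zero hpos.ne', le_div_iff₀ hpos]
  calc 1 / 2 * a ≤ 2 / Real.pi * a := by
        gcongr ?_ * a
        rw [div_le_div_iff₀ two_pos Real.pi_pos]
        linarith [Real.pi_le_four]
    _ ≤ Real.sin a := Real.mul_le_sin ha.1 ha.2

lemma one_sub_sinc_le {a : ℝ} (ha : 0 ≤ a) : 1 - Real.sinc a ≤ a ^ 2 / 6 := by
  rcases ha.eq_or_lt with rfl | hpos
  · simp
  rw [Real.sinc_of_ne_zero hpos.ne', sub_le_comm, le_div_iff₀ hpos]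
  linarith [Real.sin_gt_sub_cube hpos]

lemma mul_sin_le_mul_sin {p q : ℝ} (hp : 0 ≤ p) (hpq : p ≤ q) (hq : q ≤ Real.pi) :
    p * Real.sin q ≤ q * Real.sin p := by
  rcases (hp.trans hpq).eq_or_lt with rfl | hpos
  · simp [le_antisymm hpq hp]
  have hconc := strictConcaveOn_sin_Icc.concaveOn.2 ⟨le_rfl, Real.pi_pos.le⟩ ⟨hpos.le, hq⟩
    (sub_nonneg.2 ((div_le_one hpos).2 hpq)) (div_nonneg hp hpos.le) (sub_add_cancel 1 (p / q))
  simp only [smul_eq_mul, mul_zero, Real.sin_zero, zero_add, div_mul_cancel₀ _ hpos.ne'] at hconc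
  rwa [div_mul_eq_mul_div, div_le_iff₀ hpos, mul_comm (Real.sin p)] at hconc

lemma sq_mul_sin_add_mul_cos_le {p q : ℝ} (hp : p ∈ Icc 0 Real.pi) (hq : q ∈ Icc 0 Real.pi) :
    q ^ 2 * Real.sin q + 2 * q * Real.cos q ≤ p ^ 2 * Real.sin q + 2 * q * Real.cos p := by
  set F : ℝ → ℝ := fun r => r ^ 2 * Real.sin q + 2 * q * Real.cos r
  have hderiv : ∀ r, HasDerivAt F (2 * (r * Real.sin q - q * Real.sin r)) r := fun r =>
    (((hasDerivAt_pow 2 r).mul_const (Real.sin q)).add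
      ((Real.hasDerivAt_cos r).const_mul (2 * q))).congr_deriv (by norm_num; ring)
  have hcont : Continuous F := continuous_iff_continuousAt.2 fun r => (hderiv r).continuousAt
  rcases le_total p q with hpq | hqp
  · refine antitoneOn_of_hasDerivWithinAt_nonpos (convex_Icc 0 q) hcont.continuousOn
      (fun r _ => (hderiv r).hasDerivWithinAt) (fun r hr => ?_) ⟨hp.1, hpq⟩ ⟨hq.1, le_rfl⟩ hpq
    rw [interior_Icc] at hr
    linarith [mul_sin_le_mul_sin hr.1.le hr.2.le hq.2]
  · refine monotoneOn_of_hasDerivWithinAt_nonneg (convex_Icc q Real.pi) hcont.continuousOn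
      (fun r _ => (hderiv r).hasDerivWithinAt) (fun r hr => ?_) ⟨le_rfl, hq.2⟩ ⟨hqp, hp.2⟩ hqp
    rw [interior_Icc] at hr
    linarith [mul_sin_le_mul_sin hq.1 hr.1.le hr.2.le]

-- The tangent line inequality for the convex function `arccos ^ 2`.
lemma two_mul_cos_sub_cos_le {p q : ℝ} (hp : p ∈ Icc 0 Real.pi) (hq : q ∈ Icc 0 Real.pi) :
    2 * (Real.cos q - Real.cos p) ≤ (p ^ 2 - q ^ 2) * Real.sinc q := by
  rcases hq.1.eq_or_lt with rfl | hpos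
  · simp only [Real.cos_zero, Real.sinc_zero]
    linarith [Real.one_sub_sq_div_two_le_cos (x := p)]
  rw [Real.sinc_of_ne_zero hpos.ne', mul_div_assoc', le_div_iff₀ hpos]
  linarith [sq_mul_sin_add_mul_cos_le hp hq]

lemma sq_le_of_cos_add_cos_le {p q l m D : ℝ} (hD : D < Real.pi / 2) (hp : p ∈ Icc 0 D)
    (hq : q ∈ Icc 0 D) (hl : l ∈ Icc 0 D) (hm : m ∈ Icc 0 Real.pi)
    (h : Real.cos p + Real.cos q ≤ 2 * Real.cos (l / 2) * Real.cos m) :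
    m ^ 2 ≤ (p ^ 2 + q ^ 2) / 2 - Real.cos D / Real.pi ^ 2 * l ^ 2 := by
  have hpi := Real.pi_pos
  have hD0 : 0 ≤ D := hp.1.trans hp.2
  have hcosD : 0 < Real.cos D := Real.cos_pos_of_mem_Ioo ⟨by linarith, hD⟩
  have hcos_le : ∀ r ∈ Icc 0 D, Real.cos D ≤ Real.cos r := fun r hr =>
    Real.cos_le_cos_of_nonneg_of_le_pi hr.1 (by linarith) hr.2
  have hcos_half : 0 < Real.cos (l / 2) :=
    hcosD.trans_le (hcos_le _ ⟨by linarith [hl.1], by linarith [hl.1, hl.2]⟩)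
  have hhalf_le : Real.cos (l / 2) ≤ 1 := Real.cos_le_one _
  have hcosD_le : Real.cos D ≤ Real.cos (l / 2) * Real.cos m := by
    linarith [hcos_le p hp, hcos_le q hq]
  have hcosm : 0 < Real.cos m := pos_of_mul_pos_right (hcosD.trans_le hcosD_le) hcos_half.le
  have hcosDm : Real.cos D ≤ Real.cos m :=
    hcosD_le.trans (mul_le_of_le_one_left hcosm.le hhalf_le)
  have hm_le : m ≤ Real.pi / 2 := by
    by_contra! hlt
    exact hcosm.not_ge (Real.cos_nonpos_of_pi_div_two_le_of_le hlt.le (by linarith [hm.2]))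
  have hmul : 4 * Real.cos D * (1 - Real.cos (l / 2)) ≤
      (p ^ 2 + q ^ 2 - 2 * m ^ 2) * Real.sinc m := by
    linarith [two_mul_cos_sub_cos_le ⟨hp.1, by linarith [hp.2]⟩ hm,
      two_mul_cos_sub_cos_le ⟨hq.1, by linarith [hq.2]⟩ hm,
      mul_le_mul_of_nonneg_right hcosDm (sub_nonneg.2 hhalf_le)]
  have hnonneg : 0 ≤ p ^ 2 + q ^ 2 - 2 * m ^ 2 := nonneg_of_mul_nonneg_left
    ((mul_nonneg (by positivity) (sub_nonneg.2 hhalf_le)).trans hmul)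
    (one_half_pos.trans_le (half_le_sinc ⟨hm.1, hm_le⟩))
  have hquad : Real.cos (l / 2) ≤ 1 - 2 / Real.pi ^ 2 * (l / 2) ^ 2 :=
    Real.cos_le_one_sub_mul_cos_sq (abs_le.2 ⟨by linarith [hl.1], by linarith [hl.2]⟩)
  have hfinal : 2 * (Real.cos D / Real.pi ^ 2 * l ^ 2) ≤ p ^ 2 + q ^ 2 - 2 * m ^ 2 := by
    calc 2 * (Real.cos D / Real.pi ^ 2 * l ^ 2)
        = 4 * Real.cos D * (2 / Real.pi ^ 2 * (l / 2) ^ 2) := by ring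
      _ ≤ 4 * Real.cos D * (1 - Real.cos (l / 2)) := by gcongr; linarith
      _ ≤ p ^ 2 + q ^ 2 - 2 * m ^ 2 := hmul.trans (mul_le_of_le_one_right hnonneg
          (Real.sinc_le_one m))
  linarith

/-! ### Comparison with the sphere -/

lemma IsMinGeodesic.dist_right {Y : Type*} {d : Y → Y → ℝ} {γ : ℝ → Y} {x y : Y}
    (hγ : IsMinGeodesic d γ x y) {s : ℝ} (hs : s ∈ Icc (0 : ℝ) 1) :
    d (γ s) y = (1 - s) * d x y := by
  simpa [hγ.2.1, abs_sub_comm s, abs_of_nonneg (sub_nonneg.2 hs.2)] using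
    hγ.2.2 s hs 1 ⟨zero_le_one, le_rfl⟩

lemma inner_eq_cos_sphereDist (a b : S2) :
    inner ℝ (a : EuclideanSpace ℝ (Fin 3)) (b : EuclideanSpace ℝ (Fin 3)) =
      Real.cos (sphereDist a b) := by
  simp [sphereDist, InnerProductGeometry.cos_angle]

lemma IsMinGeodesic.sin_smul_eq {y z : S2} {γ : ℝ → S2} (hγ : IsMinGeodesic sphereDist γ y z)
    {t : ℝ} (ht : t ∈ Icc (0 : ℝ) 1) :
    Real.sin (sphereDist y z) • (γ t : EuclideanSpace ℝ (Fin 3)) =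
      Real.sin ((1 - t) * sphereDist y z) • (y : EuclideanSpace ℝ (Fin 3)) +
        Real.sin (t * sphereDist y z) • (z : EuclideanSpace ℝ (Fin 3)) := by
  set A := (1 - t) * sphereDist y z with hA
  set B := t * sphereDist y z with hB
  have hsum : sphereDist y z = A + B := by rw [hA, hB]; ring
  have hy : inner ℝ (y : EuclideanSpace ℝ (Fin 3)) (γ t) = Real.cos B := by
    rw [inner_eq_cos_sphereDist, hγ.dist_left ht]
  have hz : inner ℝ (z : EuclideanSpace ℝ (Fin 3)) (γ t) = Real.cos A := by
    rw [real_inner_comm, inner_eq_cos_sphereDist, hγ.dist_right ht]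
  have hyz : inner ℝ (y : EuclideanSpace ℝ (Fin 3)) z = Real.cos (A + B) := by
    rw [inner_eq_cos_sphereDist, hsum]
  have hself : ∀ a : S2, inner ℝ (a : EuclideanSpace ℝ (Fin 3)) a = 1 := fun a => by simp
  rw [← sub_eq_zero, ← inner_self_eq_zero (𝕜 := ℝ)]
  simp only [inner_sub_left, inner_sub_right, inner_add_left, inner_add_right,
    real_inner_smul_left, real_inner_smul_right, hself, hy, hz, hyz,
    (real_inner_comm _ _).trans hy, (real_inner_comm _ _).trans hz,
    (real_inner_comm _ _).trans hyz]
  rw [hsum, Real.sin_add, Real.cos_add]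
  linear_combination -Real.sin A ^ 2 * Real.sin_sq_add_cos_sq B -
    Real.sin B ^ 2 * Real.sin_sq_add_cos_sq A

lemma IsMinGeodesic.sin_mul_cos_eq {y z : S2} {γ : ℝ → S2} (hγ : IsMinGeodesic sphereDist γ y z)
    (x : S2) {t : ℝ} (ht : t ∈ Icc (0 : ℝ) 1) :
    Real.sin (sphereDist y z) * Real.cos (sphereDist x (γ t)) =
      Real.sin ((1 - t) * sphereDist y z) * Real.cos (sphereDist x y) +
      Real.sin (t * sphereDist y z) * Real.cos (sphereDist x z) := by
  simpa only [inner_add_right, real_inner_smul_right, inner_eq_cos_sphereDist] using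
    congrArg (inner ℝ (x : EuclideanSpace ℝ (Fin 3))) (hγ.sin_smul_eq ht)

section CAT1

variable {X : Type*} [MetricSpace X] {x y z : X} {γ : ℝ → X}

lemma IsMinGeodesic.two_mul_dist_le (hγ : IsMinGeodesic dist γ y z) (x : X) {t : ℝ}
    (ht : t ∈ Icc (0 : ℝ) 1) : 2 * dist x (γ t) ≤ dist x y + dist y z + dist z x := by
  have hy := dist_triangle x y (γ t)
  have hz := dist_triangle_right x (γ t) z
  rw [hγ.dist_left ht] at hy
  rw [hγ.dist_right ht, dist_comm x z] at hz
  linarith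

lemma IsCAT1.sin_mul_cos_le (h : IsCAT1 X)
    (hper : dist x y + dist y z + dist z x < 2 * Real.pi)
    (hγ : IsMinGeodesic dist γ y z) {t : ℝ} (ht : t ∈ Icc (0 : ℝ) 1) :
    Real.sin ((1 - t) * dist y z) * Real.cos (dist x y) +
      Real.sin (t * dist y z) * Real.cos (dist x z) ≤
      Real.sin (dist y z) * Real.cos (dist x (γ t)) := by
  obtain ⟨x', y', z', hxy, hyz, hzx, γ', hγ', hle⟩ := h.2 x y z hper γ hγ
  have hxz : sphereDist x' z' = dist x z := by
    rw [dist_comm, ← hzx, sphereDist, sphereDist, InnerProductGeometry.angle_comm]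
  have hsphere := hγ'.sin_mul_cos_eq x' ht
  rw [hyz, hxy, hxz] at hsphere
  rw [← hsphere]
  have hyz_le : dist y z ≤ Real.pi := by linarith [dist_triangle_left y z x, dist_comm x z]
  exact mul_le_mul_of_nonneg_left (Real.cos_le_cos_of_nonneg_of_le_pi dist_nonneg
    (InnerProductGeometry.angle_le_pi _ _) (hle t ht))
    (Real.sin_nonneg_of_nonneg_of_le_pi dist_nonneg hyz_le)

lemma IsCAT1.dist_geodesic_le (h : IsCAT1 X) {r : ℝ} (hr : r < Real.pi / 2) (hy : dist x y ≤ r)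
    (hz : dist x z ≤ r) (hγ : IsMinGeodesic dist γ y z) {t : ℝ} (ht : t ∈ Icc (0 : ℝ) 1) :
    dist x (γ t) ≤ r := by
  rcases eq_or_ne y z with rfl | hne
  · have hdist := hγ.dist_left ht
    rw [dist_self, mul_zero] at hdist
    rwa [← dist_eq_zero.1 hdist]
  have hyz : dist y z < Real.pi := by linarith [dist_triangle_left y z x]
  have hper : dist x y + dist y z + dist z x < 2 * Real.pi := by linarith [dist_comm z x]
  have hy' : (1 - t) * dist y z ∈ Icc 0 Real.pi :=
    ⟨mul_nonneg (sub_nonneg.2 ht.2) dist_nonneg,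
      (mul_le_of_le_one_left dist_nonneg (sub_le_self 1 ht.1)).trans hyz.le⟩
  have hz' : t * dist y z ∈ Icc 0 Real.pi :=
    ⟨mul_nonneg ht.1 dist_nonneg, (mul_le_of_le_one_left dist_nonneg ht.2).trans hyz.le⟩
  have hr0 : 0 ≤ r := dist_nonneg.trans hy
  have hcos : 0 ≤ Real.cos r :=
    Real.cos_nonneg_of_neg_pi_div_two_le_of_le (by linarith) hr.le
  have hcos_le : ∀ d ≤ r, 0 ≤ d → Real.cos r ≤ Real.cos d := fun d hd hd0 =>
    Real.cos_le_cos_of_nonneg_of_le_pi hd0 (by linarith [Real.pi_pos]) hd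
  have hle : Real.sin (dist y z) * Real.cos r ≤ Real.sin (dist y z) * Real.cos (dist x (γ t)) :=
    calc Real.sin (dist y z) * Real.cos r
        = Real.sin ((1 - t) * dist y z + t * dist y z) * Real.cos r := by ring_nf
      _ ≤ (Real.sin ((1 - t) * dist y z) + Real.sin (t * dist y z)) * Real.cos r := by
        gcongr; exact sin_add_le hy' hz'
      _ ≤ Real.sin ((1 - t) * dist y z) * Real.cos (dist x y) +
          Real.sin (t * dist y z) * Real.cos (dist x z) := by
        rw [add_mul]
        exact add_le_add
          (mul_le_mul_of_nonneg_left (hcos_le _ hy dist_nonneg) (Real.sin_nonneg_of_mem_Icc hy'))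
          (mul_le_mul_of_nonneg_left (hcos_le _ hz dist_nonneg) (Real.sin_nonneg_of_mem_Icc hz'))
      _ ≤ Real.sin (dist y z) * Real.cos (dist x (γ t)) := h.sin_mul_cos_le hper hγ ht
  have hcos_dist := le_of_mul_le_mul_left hle (Real.sin_pos_of_pos_of_lt_pi (dist_pos.2 hne) hyz)
  contrapose! hcos_dist
  exact Real.cos_lt_cos_of_nonneg_of_le_pi hr0 (by linarith [hγ.two_mul_dist_le x ht]) hcos_dist

lemma IsCAT1.cos_add_cos_le (h : IsCAT1 X) (hper : dist x y + dist y z + dist z x < 2 * Real.pi)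
    (hγ : IsMinGeodesic dist γ y z) : Real.cos (dist x y) + Real.cos (dist x z) ≤
      2 * Real.cos (dist y z / 2) * Real.cos (dist x (γ (1 / 2))) := by
  have hmem : (1 / 2 : ℝ) ∈ Icc (0 : ℝ) 1 := by norm_num
  rcases eq_or_ne y z with rfl | hne
  · have hdist := hγ.dist_left hmem
    rw [dist_self, mul_zero] at hdist
    rw [← dist_eq_zero.1 hdist, dist_self, zero_div, Real.cos_zero]
    linarith
  have hsin : 0 < Real.sin (dist y z / 2) := by
    refine Real.sin_pos_of_pos_of_lt_pi (half_pos (dist_pos.2 hne)) ?_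
    linarith [dist_nonneg (x := x) (y := y), dist_nonneg (x := z) (y := x)]
  have hdouble : Real.sin (dist y z) =
      2 * Real.sin (dist y z / 2) * Real.cos (dist y z / 2) := by
    rw [← Real.sin_two_mul, mul_div_cancel₀ _ two_ne_zero]
  have hcomp := h.sin_mul_cos_le hper hγ hmem
  rw [hdouble, sub_half, one_div_mul_eq_div] at hcomp
  refine le_of_mul_le_mul_left ?_ hsin
  linarith

lemma IsCAT1.sq_dist_midpoint_le (h : IsCAT1 X) {D : ℝ} (hD : D < Real.pi / 2)
    (hxy : dist x y ≤ D) (hxz : dist x z ≤ D) (hyz : dist y z ≤ D)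
    (hγ : IsMinGeodesic dist γ y z) : dist x (γ (1 / 2)) ^ 2 ≤
      (dist x y ^ 2 + dist x z ^ 2) / 2 - Real.cos D / Real.pi ^ 2 * dist y z ^ 2 := by
  have hper : dist x y + dist y z + dist z x < 2 * Real.pi := by
    linarith [dist_comm z x, Real.pi_pos]
  exact sq_le_of_cos_add_cos_le hD ⟨dist_nonneg, hxy⟩ ⟨dist_nonneg, hxz⟩ ⟨dist_nonneg, hyz⟩
    ⟨dist_nonneg, by linarith [hγ.two_mul_dist_le x (t := 1 / 2) (by norm_num)]⟩
    (h.cos_add_cos_le hper hγ)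

end CAT1

/-! ### The discrete evolution variational inequality -/

lemma tendsto_comparison_slope (a b c : ℝ) :
    Tendsto (fun s : ℝ => 2 * (Real.sin b * Real.cos a - Real.sin ((1 - s) * b) * Real.cos a -
      Real.sin (s * b) * Real.cos c) / s) (𝓝[>] 0)
      (𝓝 (2 * (b * (Real.cos b * Real.cos a - Real.cos c)))) := by
  have hleft : HasDerivAt (fun s : ℝ => (1 - s) * b) (-b) 0 := by
    simpa using ((hasDerivAt_id (0 : ℝ)).const_sub 1).mul_const b
  have hright : HasDerivAt (fun s : ℝ => s * b) b 0 := by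
    simpa using (hasDerivAt_id (0 : ℝ)).mul_const b
  have hderiv := (((hleft.sin.mul_const (Real.cos a)).const_sub (Real.sin b * Real.cos a)).sub
    (hright.sin.mul_const (Real.cos c))).const_mul 2
  have hslope := hderiv.tendsto_slope_zero_right
  simp only [Pi.sub_apply, zero_add, sub_zero, one_mul, zero_mul, Real.sin_zero, Real.cos_zero,
    sub_self, smul_eq_mul, mul_zero, inv_mul_eq_div] at hslope
  convert hslope using 2
  ring

section EVI

variable {X : Type*} [MetricSpace X] {x y z : X} {γ : ℝ → X}

lemma IsCAT1.sinc_mul_sinc_le (h : IsCAT1 X)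
    (hper : dist x z + dist z y + dist y x < 2 * Real.pi) (hne : z ≠ y)
    (hγ : IsMinGeodesic dist γ z y) {E : ℝ → ℝ} {E₀ : ℝ} (hE : Tendsto E (𝓝[>] 0) (𝓝 E₀))
    (hle : ∀ s ∈ Ioc (0 : ℝ) 1, s * E s ≤ dist x (γ s) ^ 2 - dist x z ^ 2) :
    Real.sinc (dist z y) * (E₀ * Real.sinc (dist x z)) ≤
      2 * (Real.cos (dist z y) * Real.cos (dist x z) - Real.cos (dist x y)) := by
  have hpos : 0 < dist z y := dist_pos.2 hne
  have hzy : dist z y ≤ Real.pi := by linarith [dist_triangle_left z y x, dist_comm x y]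
  have hxz : dist x z ≤ Real.pi := by linarith [dist_triangle x y z, dist_comm y x, dist_comm y z]
  have hdist : Tendsto (fun s => dist x (γ s)) (𝓝[>] 0) (𝓝 (dist x z)) :=
    tendsto_const_nhds.dist hγ.tendsto_left
  have hsin : Real.sin (dist z y) = dist z y * Real.sinc (dist z y) := by
    rw [Real.sinc_of_ne_zero hpos.ne', mul_div_cancel₀ _ hpos.ne']
  have hlim : Real.sin (dist z y) * (E₀ * Real.sinc (dist x z)) ≤
      2 * (dist z y * (Real.cos (dist z y) * Real.cos (dist x z) - Real.cos (dist x y))) := by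
    refine le_of_tendsto_of_tendsto (tendsto_const_nhds.mul
      (hE.mul ((Real.continuous_sinc.tendsto _).comp hdist))) (tendsto_comparison_slope _ _ _) ?_
    filter_upwards [Ioc_mem_nhdsGT zero_lt_one] with s hs
    have hsI : s ∈ Icc (0 : ℝ) 1 := Ioc_subset_Icc_self hs
    have hγs : dist x (γ s) ∈ Icc 0 Real.pi :=
      ⟨dist_nonneg, by linarith [hγ.two_mul_dist_le x hsI]⟩
    have hcos : s * E s * Real.sinc (dist x (γ s)) ≤
        2 * (Real.cos (dist x z) - Real.cos (dist x (γ s))) := by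
      linarith [mul_le_mul_of_nonneg_right (hle s hs) (sinc_nonneg hγs),
        two_mul_cos_sub_cos_le ⟨dist_nonneg, hxz⟩ hγs]
    rw [Function.comp_apply, le_div_iff₀ hs.1]
    linarith [h.sin_mul_cos_le hper hγ hsI, mul_le_mul_of_nonneg_left hcos
      (Real.sin_nonneg_of_mem_Icc ⟨hpos.le, hzy⟩)]
  rw [hsin] at hlim
  exact le_of_mul_le_mul_left (by linarith) hpos

lemma le_of_sinc_mul_sinc_le {a b c E : ℝ} (ha : a ∈ Icc 0 (Real.pi / 2))
    (hb : b ∈ Icc 0 (Real.pi / 2)) (hc : c ∈ Icc 0 (Real.pi / 2))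
    (h : Real.sinc b * (E * Real.sinc a) ≤ 2 * (Real.cos b * Real.cos a - Real.cos c)) :
    E ≤ c ^ 2 - b ^ 2 + 2 * a ^ 2 := by
  have hpi : ∀ {r}, r ∈ Icc 0 (Real.pi / 2) → r ∈ Icc 0 Real.pi := fun hr =>
    ⟨hr.1, hr.2.trans (by linarith [Real.pi_pos])⟩
  have hcosb : 0 ≤ Real.cos b :=
    Real.cos_nonneg_of_neg_pi_div_two_le_of_le (by linarith [hb.1, Real.pi_pos]) hb.2
  have hmul : Real.sinc b * (E * Real.sinc a) ≤ Real.sinc b * (c ^ 2 - b ^ 2) := by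
    linarith [mul_le_of_le_one_right hcosb (Real.cos_le_one a),
      two_mul_cos_sub_cos_le (hpi hc) (hpi hb)]
  have hE : E * Real.sinc a ≤ c ^ 2 - b ^ 2 :=
    le_of_mul_le_mul_left hmul (one_half_pos.trans_le (half_le_sinc hb))
  rcases le_total E 0 with hE0 | hE0
  · linarith [mul_le_mul_of_nonpos_left (Real.sinc_le_one a) hE0, sq_nonneg a]
  · have hc2 : c ^ 2 ≤ 2 ^ 2 := by
      gcongr
      · exact hc.1
      · linarith [hc.2, Real.pi_le_four]
    have hE8 : E ≤ 8 := by
      linarith [mul_le_mul_of_nonneg_left (half_le_sinc ha) hE0, sq_nonneg b]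
    linarith [mul_le_mul_of_nonneg_left (one_sub_sinc_le ha.1) hE0,
      mul_le_mul_of_nonneg_right hE8 (sq_nonneg a), sq_nonneg a]

lemma IsCAT1.first_variation_le (h : IsCAT1 X) {D : ℝ} (hD : D < Real.pi / 2)
    (hxz : dist x z ≤ D) (hxy : dist x y ≤ D) (hzy : dist z y ≤ D) (hne : z ≠ y)
    (hγ : IsMinGeodesic dist γ z y) {E : ℝ → ℝ} {E₀ : ℝ} (hE : Tendsto E (𝓝[>] 0) (𝓝 E₀))
    (hle : ∀ s ∈ Ioc (0 : ℝ) 1, s * E s ≤ dist x (γ s) ^ 2 - dist x z ^ 2) :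
    E₀ ≤ dist x y ^ 2 - dist z y ^ 2 + 2 * dist x z ^ 2 :=
  le_of_sinc_mul_sinc_le ⟨dist_nonneg, hxz.trans hD.le⟩ ⟨dist_nonneg, hzy.trans hD.le⟩
    ⟨dist_nonneg, hxy.trans hD.le⟩ <|
    h.sinc_mul_sinc_le (by linarith [dist_comm y x, Real.pi_pos]) hne hγ hE hle

variable {φ : X → EReal} {lam τ : ℝ}

lemma ConvexAlong.mul_le_sq_dist_sub (hγ : ConvexAlong φ lam γ z y) (hbot : ∀ x, φ x ≠ ⊥)
    (hτ : 0 < τ) (hy : y ∈ dom φ) (hz : z ∈ proxSet φ τ x) {s : ℝ} (hs : s ∈ Icc (0 : ℝ) 1) :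
    s * (2 * τ * (val φ z - val φ y + lam / 2 * (1 - s) * dist z y ^ 2)) ≤
      dist x (γ s) ^ 2 - dist x z ^ 2 := by
  have hmin := ((mem_proxSet_iff hbot ⟨y, hy⟩).1 hz).2 _ (mem_dom_of_le (hγ s hs))
  have hprox : (dist x z ^ 2 - dist x (γ s) ^ 2) / (2 * τ) ≤ val φ (γ s) - val φ z := by
    rw [sub_div]
    linarith
  rw [div_le_iff₀ (by positivity)] at hprox
  linarith [mul_le_mul_of_nonneg_left (val_le_of_le hbot (hγ s hs)) hτ.le]

lemma tendsto_prox_secant (a b c d : ℝ) :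
    Tendsto (fun s : ℝ => a * (b + c * (1 - s) * d)) (𝓝[>] 0) (𝓝 (a * (b + c * d))) :=
  (Continuous.tendsto' (by fun_prop) 0 _ (by ring)).mono_left nhdsWithin_le_nhds

lemma IsCAT1.evi (h : IsCAT1 X) (hbot : ∀ x, φ x ≠ ⊥) {D : ℝ} (hconv : IsLambdaConvex φ lam)
    (hD : D < Real.pi / 2) (hdiam : ∀ x ∈ dom φ, ∀ y ∈ dom φ, dist x y ≤ D) (hτ : 0 < τ)
    (hx : x ∈ dom φ) (hy : y ∈ dom φ) (hz : z ∈ proxSet φ τ x) :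
    dist z y ^ 2 ≤ dist x y ^ 2 + 2 * dist x z ^ 2 + 2 * τ * (val φ y - val φ z)
      + |lam| * τ * dist z y ^ 2 := by
  rcases eq_or_ne z y with rfl | hne
  · simp only [dist_self, sub_self]
    linarith [sq_nonneg (dist x z)]
  have hzd : z ∈ dom φ := ((mem_proxSet_iff hbot ⟨x, hx⟩).1 hz).1
  obtain ⟨γ, hγ, hγc⟩ := hconv z hzd y hy
  have hvar := h.first_variation_le hD (hdiam _ hx _ hzd) (hdiam _ hx _ hy) (hdiam _ hzd _ hy)
    hne hγ (tendsto_prox_secant _ _ _ _)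
    fun s hs => hγc.mul_le_sq_dist_sub hbot hτ hy hz (Ioc_subset_Icc_self hs)
  linarith [mul_le_mul_of_nonneg_left (neg_le_abs lam) (mul_nonneg hτ.le (sq_nonneg (dist z y)))]

lemma exists_ball_val_sub_one_le (hbot : ∀ x, φ x ≠ ⊥) (hlsc : LowerSemicontinuous φ)
    (hx : x ∈ dom φ) : ∃ r > 0, ∀ y ∈ dom φ, dist x y < r → val φ x - 1 ≤ val φ y := by
  have hlt : ((val φ x - 1 : ℝ) : EReal) < φ x := by
    rw [← coe_val hbot hx]
    exact_mod_cast sub_one_lt _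
  obtain ⟨r, hr, hball⟩ := Metric.eventually_nhds_iff.1 (hlsc x _ hlt)
  refine ⟨r, hr, fun y hy hd => ?_⟩
  have hval : ((val φ x - 1 : ℝ) : EReal) < φ y := hball (by rwa [dist_comm])
  rw [← coe_val hbot hy, EReal.coe_lt_coe_iff] at hval
  exact hval.le

lemma IsLambdaConvex.val_sub_le_of_forall_dist_lt (hconv : IsLambdaConvex φ lam)
    (hbot : ∀ x, φ x ≠ ⊥) (hx : x ∈ dom φ) (hy : y ∈ dom φ) {r : ℝ} (hr : 0 < r)
    (hball : ∀ y ∈ dom φ, dist x y < r → val φ x - 1 ≤ val φ y) :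
    val φ x - val φ y ≤ 1 + 1 / r ^ 2 + (1 + |lam|) * dist x y ^ 2 := by
  have hlam := abs_nonneg lam
  rcases lt_or_ge (dist x y) r with hlt | hge
  · have hpos : 0 ≤ 1 / r ^ 2 + (1 + |lam|) * dist x y ^ 2 := by positivity
    linarith [hball y hy hlt]
  obtain ⟨γ, hγ, hγc⟩ := hconv x hx y hy
  have hpos : 0 < dist x y := hr.trans_le hge
  set s := r / (2 * dist x y) with hs
  have hs0 : 0 < s := by positivity
  have hs1 : s ≤ 1 := by
    rw [hs, div_le_one (by positivity)]
    linarith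
  have hmem : s ∈ Icc (0 : ℝ) 1 := ⟨hs0.le, hs1⟩
  have hdist : dist x (γ s) = r / 2 := by
    rw [hγ.dist_left hmem, hs]
    field_simp
  have hlow := hball _ (mem_dom_of_le (hγc s hmem)) (by linarith)
  have hmul : s * (val φ x - val φ y) ≤ s * (1 / s - lam / 2 * (1 - s) * dist x y ^ 2) := by
    linarith [val_le_of_le hbot (hγc s hmem), mul_one_div_cancel hs0.ne']
  have hinv : 1 / s ≤ dist x y ^ 2 + 1 / r ^ 2 := by
    rw [show 1 / s = 2 * dist x y * (1 / r) by rw [hs]; field_simp, ← one_div_pow]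
    exact two_mul_le_add_sq _ _
  have hcoef : -(lam / 2 * (1 - s)) ≤ |lam| := by
    linarith [mul_le_mul_of_nonneg_right (neg_le_abs lam) (sub_nonneg.2 hs1),
      mul_nonneg hlam hs0.le]
  linarith [le_of_mul_le_mul_left hmul hs0, mul_le_mul_of_nonneg_right hcoef (sq_nonneg (dist x y))]

lemma IsLambdaConvex.exists_val_sub_le (hconv : IsLambdaConvex φ lam) (hbot : ∀ x, φ x ≠ ⊥)
    (hlsc : LowerSemicontinuous φ) (hx : x ∈ dom φ) :
    ∃ A, ∀ y ∈ dom φ, val φ x - val φ y ≤ A + (1 + |lam|) * dist x y ^ 2 := by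
  obtain ⟨r, hr, hball⟩ := exists_ball_val_sub_one_le hbot hlsc hx
  exact ⟨_, fun y hy => hconv.val_sub_le_of_forall_dist_lt hbot hx hy hr hball⟩

lemma exists_tendsto_minimizing [CompleteSpace X] {s : Set X} (hs : s.Nonempty) {ψ : X → ℝ}
    (hbdd : BddBelow (ψ '' s)) {c : ℝ} (hc : 0 < c)
    (hmid : ∀ u ∈ s, ∀ v ∈ s, ∃ w ∈ s, ψ w ≤ (ψ u + ψ v) / 2 - c * dist u v ^ 2) :
    ∃ (u : ℕ → X) (z : X), (∀ n, u n ∈ s) ∧ Tendsto u atTop (𝓝 z) ∧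
      Tendsto (fun n => ψ (u n)) atTop (𝓝 (sInf (ψ '' s))) := by
  obtain ⟨v, hanti, hv, hmem⟩ := exists_seq_tendsto_sInf (hs.image ψ) hbdd
  choose u hu huv using hmem
  set b : ℕ → ℝ := fun n => √((v n - sInf (ψ '' s)) / c)
  have hb : Tendsto b atTop (𝓝 0) := by
    simpa using ((hv.sub_const (sInf (ψ '' s))).div_const c).sqrt
  have hcauchy : CauchySeq u := by
    refine cauchySeq_of_le_tendsto_0 b (fun n m N hn hm => Real.le_sqrt_of_sq_le ?_) hb
    obtain ⟨w, hw, hle⟩ := hmid _ (hu n) _ (hu m)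
    rw [huv, huv] at hle
    rw [le_div_iff₀ hc]
    linarith [csInf_le hbdd ⟨w, hw, rfl⟩, hanti hn, hanti hm]
  obtain ⟨z, hz⟩ := cauchySeq_tendsto_of_complete hcauchy
  exact ⟨u, z, hu, hz, by simpa only [huv] using hv⟩

lemma IsCAT1.exists_midpoint_le (h : IsCAT1 X) (hbot : ∀ x, φ x ≠ ⊥) {D : ℝ}
    (hconv : IsLambdaConvex φ lam) (hD : D < Real.pi / 2)
    (hdiam : ∀ x ∈ dom φ, ∀ y ∈ dom φ, dist x y ≤ D) (hτ : 0 < τ)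
    (hτs : τ * (|lam| + 1) ≤ Real.cos D / Real.pi ^ 2) (hx : x ∈ dom φ) {u v : X}
    (hu : u ∈ dom φ) (hv : v ∈ dom φ) :
    ∃ w ∈ dom φ, val φ w + dist x w ^ 2 / (2 * τ) ≤
      (val φ u + dist x u ^ 2 / (2 * τ) + (val φ v + dist x v ^ 2 / (2 * τ))) / 2
        - 1 / 4 * dist u v ^ 2 := by
  obtain ⟨γ, hγ, hγc⟩ := hconv u hu v hv
  have hmid := hγc (1 / 2) (by norm_num)
  refine ⟨γ (1 / 2), mem_dom_of_le hmid, ?_⟩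
  have hsq : dist x (γ (1 / 2)) ^ 2 / (2 * τ) ≤
      (dist x u ^ 2 / (2 * τ) + dist x v ^ 2 / (2 * τ)) / 2 - (|lam| + 1) / 2 * dist u v ^ 2 :=
    calc dist x (γ (1 / 2)) ^ 2 / (2 * τ)
        ≤ ((dist x u ^ 2 + dist x v ^ 2) / 2 - τ * (|lam| + 1) * dist u v ^ 2) / (2 * τ) := by
          gcongr
          linarith [h.sq_dist_midpoint_le hD (hdiam _ hx _ hu) (hdiam _ hx _ hv)
            (hdiam _ hu _ hv) hγ, mul_le_mul_of_nonneg_right hτs (sq_nonneg (dist u v))]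
      _ = _ := by field_simp
  linarith [val_le_of_le hbot hmid, sq_nonneg (dist u v),
    mul_le_mul_of_nonneg_right (neg_le_abs lam) (sq_nonneg (dist u v)),
    mul_nonneg (abs_nonneg lam) (sq_nonneg (dist u v))]

lemma IsCAT1.proxSet_nonempty [CompleteSpace X] (h : IsCAT1 X) (hbot : ∀ x, φ x ≠ ⊥)
    (hlsc : LowerSemicontinuous φ) {D : ℝ} (hconv : IsLambdaConvex φ lam)
    (hD : D < Real.pi / 2) (hdiam : ∀ x ∈ dom φ, ∀ y ∈ dom φ, dist x y ≤ D)
    (hx : x ∈ dom φ) (hτ : 0 < τ) (hτs : τ * (|lam| + 1) ≤ Real.cos D / Real.pi ^ 2) :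
    (proxSet φ τ x).Nonempty := by
  set ψ : X → ℝ := fun y => val φ y + dist x y ^ 2 / (2 * τ) with hψ
  obtain ⟨A, hA⟩ := hconv.exists_val_sub_le hbot hlsc hx
  have hbdd : BddBelow (ψ '' dom φ) := by
    refine ⟨val φ x - (A + (1 + |lam|) * D ^ 2), ?_⟩
    rintro _ ⟨y, hy, rfl⟩
    have hdist : (1 + |lam|) * dist x y ^ 2 ≤ (1 + |lam|) * D ^ 2 := by
      gcongr
      exact hdiam x hx y hy
    have hpos : 0 ≤ dist x y ^ 2 / (2 * τ) := by positivity
    simp only [hψ]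
    linarith [hA y hy]
  obtain ⟨u, z, hu, huz, hψu⟩ := exists_tendsto_minimizing ⟨x, hx⟩ hbdd (by norm_num)
    fun a ha b hb => h.exists_midpoint_le hbot hconv hD hdiam hτ hτs hx ha hb
  obtain ⟨hz, hval⟩ := mem_dom_and_val_le_of_tendsto hbot hlsc huz
    (Eventually.of_forall hu) (Eventually.of_forall fun n => (add_sub_cancel_right _ _).ge)
    (hψu.sub (((tendsto_const_nhds.dist huz).pow 2).div_const (2 * τ)))
  exact ⟨z, (mem_proxSet_iff hbot ⟨x, hx⟩).2 ⟨hz, fun y hy =>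
    (le_sub_iff_add_le.1 hval).trans (csInf_le hbdd ⟨y, hy, rfl⟩)⟩⟩

lemma IsCAT1.eviSetting [CompleteSpace X] (h : IsCAT1 X) (hbot : ∀ x, φ x ≠ ⊥)
    (hlsc : LowerSemicontinuous φ) {D : ℝ} (hconv : IsLambdaConvex φ lam)
    (hD : D ∈ Ico 0 (Real.pi / 2)) (hdiam : ∀ x ∈ dom φ, ∀ y ∈ dom φ, dist x y ≤ D) :
    EVISetting φ 2 |lam| where
  ne_bot := hbot
  lowerSemicontinuous := hlsc
  C_nonneg := zero_le_two
  L_nonneg := abs_nonneg _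
  exists_prox := by
    have hcos : 0 < Real.cos D := Real.cos_pos_of_mem_Ioo ⟨by linarith [hD.1, Real.pi_pos], hD.2⟩
    refine ⟨Real.cos D / Real.pi ^ 2 / (|lam| + 1), by positivity, fun x hx τ hτ hτs => ?_⟩
    exact h.proxSet_nonempty hbot hlsc hconv hD.2 hdiam hx hτ
      ((lt_div_iff₀ (by positivity)).1 hτs).le
  evi τ hτ x hx y hy z hz := h.evi hbot hconv hD.2 hdiam hτ hx hy hz

lemma ConvexAlong.le_of_tendsto_sq_dist {p : X} {K l : ℝ}
    (hγ : ConvexAlong (fun w => ((dist p w ^ 2 : ℝ) : EReal)) K γ x y)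
    (hl : Tendsto (fun s : ℝ => (dist p (γ s) ^ 2 - dist p x ^ 2) / s) (𝓝[>] 0) (𝓝 l)) :
    l ≤ dist p y ^ 2 - dist p x ^ 2 - K / 2 * dist x y ^ 2 := by
  refine le_of_tendsto_of_tendsto hl ((Continuous.tendsto'
    (f := fun s : ℝ => dist p y ^ 2 - dist p x ^ 2 - K / 2 * (1 - s) * dist x y ^ 2)
    (by fun_prop) 0 _ (by ring)).mono_left nhdsWithin_le_nhds) ?_
  filter_upwards [Ioc_mem_nhdsGT zero_lt_one] with s hs
  have hconv := EReal.coe_le_coe_iff.1 (hγ s (Ioc_subset_Icc_self hs))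
  simp only [EReal.toReal_coe] at hconv
  rw [div_le_iff₀ hs.1]
  linarith

lemma CommutativeSetting.evi {K : ℝ} (h : CommutativeSetting φ lam K) (hbot : ∀ x, φ x ≠ ⊥)
    (hτ : 0 < τ) (hy : y ∈ dom φ) (hz : z ∈ proxSet φ τ x) :
    dist z y ^ 2 ≤ dist x y ^ 2 + |K| * dist x z ^ 2 + 2 * τ * (val φ y - val φ z)
      + |lam| * τ * dist z y ^ 2 := by
  obtain ⟨Γ, -, hjoin, hcomm, hK, hφ⟩ := h
  obtain ⟨γ, hγ, rfl, rfl⟩ := hjoin z x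
  obtain ⟨η, hη, hη0, rfl⟩ := hjoin (γ 0) y
  have hzd : η 0 ∈ dom φ := hη0 ▸ ((mem_proxSet_iff hbot ⟨_, hy⟩).1 hz).1
  obtain ⟨l, hγl, hηl⟩ := hcomm γ hγ η hη hη0.symm
  have hupper : l ≤ dist (η 1) (γ 1) ^ 2 - dist (η 1) (γ 0) ^ 2 -
      K / 2 * dist (γ 0) (γ 1) ^ 2 :=
    (hK γ hγ (η 1)).le_of_tendsto_sq_dist (by simpa only [dist_comm (η 1)] using hγl)
  have hlower : 2 * τ * (val φ (γ 0) - val φ (η 1) + lam / 2 * dist (γ 0) (η 1) ^ 2) ≤ l := by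
    refine le_of_tendsto_of_tendsto (tendsto_prox_secant _ _ _ _) hηl ?_
    filter_upwards [Ioc_mem_nhdsGT zero_lt_one] with s hs
    have hconv := hφ η hη hzd hy
    rw [hη0] at hconv
    rw [le_div_iff₀ hs.1, mul_comm, dist_comm (η s), dist_comm (γ 0) (γ 1)]
    exact hconv.mul_le_sq_dist_sub hbot hτ hy hz (Ioc_subset_Icc_self hs)
  rw [dist_comm (η 1), dist_comm (η 1), dist_comm (γ 0) (γ 1)] at hupper
  linarith [mul_le_mul_of_nonneg_left (neg_le_abs lam)
      (mul_nonneg hτ.le (sq_nonneg (dist (γ 0) (η 1)))),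
    mul_le_mul_of_nonneg_right (neg_le_abs K) (sq_nonneg (dist (γ 1) (γ 0))),
    mul_nonneg (abs_nonneg K) (sq_nonneg (dist (γ 1) (γ 0)))]

lemma CommutativeSetting.eviSetting {K : ℝ} (h : CommutativeSetting φ lam K)
    (hbot : ∀ x, φ x ≠ ⊥) (hlsc : LowerSemicontinuous φ) (hcoer : Coercive φ) :
    EVISetting φ |K| |lam| where
  ne_bot := hbot
  lowerSemicontinuous := hlsc
  C_nonneg := abs_nonneg _
  L_nonneg := abs_nonneg _
  exists_prox := by
    obtain ⟨τs, hτs, hprox⟩ := hcoer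
    obtain ⟨r, hr, hrτ⟩ := ENNReal.lt_iff_exists_nnreal_btwn.1 hτs
    refine ⟨r, by exact_mod_cast hr, fun x _ τ hτ hτr => (hprox x τ hτ (lt_trans ?_ hrτ)).2⟩
    exact (ENNReal.ofReal_lt_coe_iff hτ.le).2 hτr
  evi _ hτ _ _ _ hy _ hz := h.evi hbot hτ hy hz

end EVI

/-! ### The restarted flow -/

section Restart

variable {X : Type*} [MetricSpace X] {φ : X → EReal} {c x y : X}

lemma restrictBall_of_le (h : dist x c ≤ Real.pi / 6) : restrictBall φ c x = φ x :=
  if_pos h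

lemma restrictBall_of_lt (h : Real.pi / 6 < dist x c) : restrictBall φ c x = ⊤ :=
  if_neg h.not_ge

lemma le_restrictBall (c x : X) : φ x ≤ restrictBall φ c x := by
  rcases le_or_gt (dist x c) (Real.pi / 6) with h | h
  · exact (restrictBall_of_le h).ge
  · exact le_top.trans_eq (restrictBall_of_lt h).symm

lemma mem_dom_restrictBall :
    x ∈ dom (restrictBall φ c) ↔ dist x c ≤ Real.pi / 6 ∧ x ∈ dom φ := by
  by_cases h : dist x c ≤ Real.pi / 6 <;> simp [dom, restrictBall, h]

lemma center_mem_dom_restrictBall (hc : c ∈ dom φ) : c ∈ dom (restrictBall φ c) :=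
  mem_dom_restrictBall.2 ⟨by rw [dist_self]; positivity, hc⟩

lemma val_restrictBall (hx : x ∈ dom (restrictBall φ c)) : val (restrictBall φ c) x = val φ x :=
  congrArg EReal.toReal (restrictBall_of_le (mem_dom_restrictBall.1 hx).1)

lemma restrictBall_ne_bot (hbot : ∀ x, φ x ≠ ⊥) (c x : X) : restrictBall φ c x ≠ ⊥ :=
  ne_bot_of_le_ne_bot (hbot x) (le_restrictBall c x)

lemma lowerSemicontinuous_restrictBall (hlsc : LowerSemicontinuous φ) (c : X) :
    LowerSemicontinuous (restrictBall φ c) := by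
  intro x a ha
  rcases le_or_gt (dist x c) (Real.pi / 6) with h | h
  · rw [restrictBall_of_le h] at ha
    exact (hlsc x a ha).mono fun w hw => hw.trans_le (le_restrictBall c w)
  · rw [restrictBall_of_lt h] at ha
    have houtside : ∀ᶠ w in 𝓝 x, Real.pi / 6 < dist w c :=
      (continuous_id.dist continuous_const).continuousAt.eventually (lt_mem_nhds h)
    exact houtside.mono fun w hw => ha.trans_eq (restrictBall_of_lt hw).symm

lemma dist_le_of_mem_dom_restrictBall (hx : x ∈ dom (restrictBall φ c))
    (hy : y ∈ dom (restrictBall φ c)) : dist x y ≤ Real.pi / 3 := by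
  linarith [dist_triangle_right x y c, (mem_dom_restrictBall.1 hx).1, (mem_dom_restrictBall.1 hy).1]

lemma IsCAT1.isLambdaConvex_restrictBall (h : IsCAT1 X) {lam : ℝ} (hconv : IsLambdaConvex φ lam)
    (c : X) : IsLambdaConvex (restrictBall φ c) lam := by
  intro x hx y hy
  obtain ⟨hxc, hxd⟩ := mem_dom_restrictBall.1 hx
  obtain ⟨hyc, hyd⟩ := mem_dom_restrictBall.1 hy
  obtain ⟨γ, hγ, hγc⟩ := hconv x hxd y hyd
  refine ⟨γ, hγ, fun t ht => ?_⟩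
  have hball : dist (γ t) c ≤ Real.pi / 6 := by
    rw [dist_comm] at hxc hyc ⊢
    exact h.dist_geodesic_le (by linarith [Real.pi_pos]) hxc hyc hγ ht
  rw [restrictBall_of_le hball, restrictBall_of_le hxc, restrictBall_of_le hyc]
  exact hγc t ht

lemma IsCAT1.eviSetting_restrictBall [CompleteSpace X] (h : IsCAT1 X) (hbot : ∀ x, φ x ≠ ⊥)
    (hlsc : LowerSemicontinuous φ) {lam : ℝ} (hconv : IsLambdaConvex φ lam) (c : X) :
    EVISetting (restrictBall φ c) 2 |lam| :=
  h.eviSetting (restrictBall_ne_bot hbot c) (lowerSemicontinuous_restrictBall hlsc c)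
    (h.isLambdaConvex_restrictBall hconv c) ⟨by positivity, by linarith [Real.pi_pos]⟩
    fun _ hx _ hy => dist_le_of_mem_dom_restrictBall hx hy

lemma localSlope_restrictBall (c : X) : localSlope (restrictBall φ c) c = localSlope φ c := by
  refine limsup_congr ?_
  have hball : ∀ᶠ y in 𝓝[≠] c, dist y c ≤ Real.pi / 6 :=
    nhdsWithin_le_nhds (Metric.closedBall_mem_nhds c (by positivity))
  filter_upwards [hball] with y hy
  rw [restrictBall_of_le hy, restrictBall_of_le (by rw [dist_self]; positivity)]

lemma IsGradientCurve.mem_dom_of_restrictBall {η : ℝ≥0 → X}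
    (hη : IsGradientCurve (restrictBall φ c) c η) (hbot : ∀ x, φ x ≠ ⊥)
    (hlsc : LowerSemicontinuous φ) (hc : c ∈ dom φ) (t : ℝ≥0) : η t ∈ dom φ :=
  (mem_dom_restrictBall.1 (hη.mem_dom (restrictBall_ne_bot hbot c)
    (lowerSemicontinuous_restrictBall hlsc c) (center_mem_dom_restrictBall hc) t)).2

lemma IsGradientCurve.sq_dist_le_of_restrictBall {η : ℝ≥0 → X}
    (hη : IsGradientCurve (restrictBall φ c) c η) (hbot : ∀ x, φ x ≠ ⊥)
    (hlsc : LowerSemicontinuous φ) (hc : c ∈ dom φ) (t : ℝ≥0) :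
    dist c (η t) ^ 2 ≤ 2 * t * (val φ c - val φ (η t)) := by
  have hbot' := restrictBall_ne_bot hbot c
  have hlsc' := lowerSemicontinuous_restrictBall hlsc c
  have hc' := center_mem_dom_restrictBall hc
  simpa only [val_restrictBall hc', val_restrictBall (hη.mem_dom hbot' hlsc' hc' t)] using
    hη.sq_dist_le hbot' hlsc' hc' t

lemma dist_eq_of_hittingTime_eq {η : ℝ≥0 → X} (hη : Continuous η) {a : ℝ≥0}
    (h : hittingTime c η = a) : dist (η a) c = Real.pi / 6 := by
  set S : Set ℝ≥0 := {t | dist (η t) c = Real.pi / 6}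
  have hne : S.Nonempty := by
    by_contra! hempty
    have hnever : ∀ t, dist (η t) c ≠ Real.pi / 6 := eq_empty_iff_forall_notMem.1 hempty
    simp [hittingTime, hnever] at h
  have hclosed : IsClosed S := isClosed_eq (hη.dist continuous_const) continuous_const
  have hmem : sInf S ∈ S := hclosed.csInf_mem hne (OrderBot.bddBelow S)
  have heq : hittingTime c η = (sInf S : ℝ≥0) :=
    le_antisymm (iInf₂_le (sInf S) hmem)
      (le_iInf₂ fun t ht => ENNReal.coe_le_coe.2 (csInf_le (OrderBot.bddBelow S) ht))
  rwa [ENNReal.coe_inj.1 (h.symm.trans heq)]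

lemma hittingTime_eq_top {η : ℝ≥0 → X} (hη : Continuous η)
    (h : ∀ t : ℝ≥0, t ≤ hittingTime c η → η t = c) : hittingTime c η = ⊤ := by
  by_contra hne
  have hhit := dist_eq_of_hittingTime_eq hη (ENNReal.coe_toNNReal hne).symm
  rw [h _ (ENNReal.coe_toNNReal hne).le, dist_self] at hhit
  linarith [Real.pi_pos]

lemma hittingTime_pos {η : ℝ≥0 → X} (hη : Continuous η) (h0 : η 0 = c) :
    0 < hittingTime c η := by
  refine pos_iff_ne_zero.2 fun hzero => ?_
  have hhit := dist_eq_of_hittingTime_eq (a := 0) hη hzero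
  rw [h0, dist_self] at hhit
  linarith [Real.pi_pos]

lemma sq_natCast_mul_le {T v : ℕ → ℝ} {r : ℝ} (hT : ∀ n, 0 ≤ T n) (hv : Antitone v)
    (hstep : ∀ n, r ^ 2 ≤ 2 * T n * (v n - v (n + 1))) (n : ℕ) :
    (n * r) ^ 2 ≤ 2 * (∑ i ∈ Finset.range n, T i) * (v 0 - v n) := by
  induction n with
  | zero => simp
  | succ n ih =>
    calc ((n + 1 : ℕ) * r) ^ 2 = (n * r + r) ^ 2 := by push_cast; ring
      _ ≤ (2 * ∑ i ∈ Finset.range n, T i + 2 * T n) * (v 0 - v n + (v n - v (n + 1))) :=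
        add_sq_le_add_mul_add (mul_nonneg two_pos.le (Finset.sum_nonneg fun i _ => hT i))
          (mul_nonneg two_pos.le (hT n)) (sub_nonneg.2 (hv n.zero_le))
          (sub_nonneg.2 (hv n.le_succ)) ih (hstep n)
      _ = 2 * (∑ i ∈ Finset.range (n + 1), T i) * (v 0 - v (n + 1)) := by
        rw [Finset.sum_range_succ]
        ring

lemma IsLambdaConvex.exists_lt_sum_of_sq_le (hbot : ∀ x, φ x ≠ ⊥) (hlsc : LowerSemicontinuous φ)
    {lam : ℝ} (hconv : IsLambdaConvex φ lam) {r : ℝ} (hr : 0 < r) {c : ℕ → X} {T : ℕ → ℝ}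
    (hc : ∀ n, c n ∈ dom φ) (hT : ∀ n, 0 ≤ T n) (hdist : ∀ n, dist (c n) (c (n + 1)) = r)
    (hstep : ∀ n, r ^ 2 ≤ 2 * T n * (val φ (c n) - val φ (c (n + 1)))) :
    ∃ n, 1 / (4 * (1 + |lam|)) < ∑ i ∈ Finset.range n, T i := by
  by_contra! hsum
  have hanti : Antitone fun n => val φ (c n) := antitone_nat_of_succ_le fun n =>
    (sub_pos.1 (pos_of_mul_pos_right ((pow_pos hr 2).trans_le (hstep n))
      (mul_nonneg two_pos.le (hT n)))).le
  obtain ⟨A, hA⟩ := hconv.exists_val_sub_le hbot hlsc (hc 0)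
  have hbound (n : ℕ) : (n * r) ^ 2 ≤ A / (1 + |lam|) := by
    have hd : dist (c 0) (c n) ≤ n * r := by
      simpa using dist_le_range_sum_of_dist_le n fun {k} _ => (hdist k).le
    have hdrop : val φ (c 0) - val φ (c n) ≤ A + (1 + |lam|) * (n * r) ^ 2 :=
      (hA _ (hc n)).trans (by gcongr)
    have hdrop_nonneg : 0 ≤ val φ (c 0) - val φ (c n) := sub_nonneg.2 (hanti n.zero_le)
    have hsq : (n * r) ^ 2 ≤ 2 * (1 / (4 * (1 + |lam|))) * (A + (1 + |lam|) * (n * r) ^ 2) :=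
      (sq_natCast_mul_le hT hanti hstep n).trans (by gcongr; exact hsum n)
    have hhalf : 2 * (1 / (4 * (1 + |lam|))) * (A + (1 + |lam|) * (n * r) ^ 2) =
        (A / (1 + |lam|) + (n * r) ^ 2) / 2 := by
      field_simp
      ring
    linarith
  obtain ⟨n, hn⟩ := exists_nat_gt (√(A / (1 + |lam|)) / r)
  rw [div_lt_iff₀ hr] at hn
  exact (hbound n).not_gt (Real.lt_sq_of_sqrt_lt hn)

/-- The coefficient of the squared distance in `IsLambdaConvex.exists_val_sub_le` does not depend on
the base point, so that every tail of `∑ T n` exceeds the same positive constant. -/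
lemma IsLambdaConvex.not_summable_of_sq_le (hbot : ∀ x, φ x ≠ ⊥) (hlsc : LowerSemicontinuous φ)
    {lam : ℝ} (hconv : IsLambdaConvex φ lam) {r : ℝ} (hr : 0 < r) {c : ℕ → X} {T : ℕ → ℝ}
    (hc : ∀ n, c n ∈ dom φ) (hT : ∀ n, 0 ≤ T n) (hdist : ∀ n, dist (c n) (c (n + 1)) = r)
    (hstep : ∀ n, r ^ 2 ≤ 2 * T n * (val φ (c n) - val φ (c (n + 1)))) : ¬ Summable T := by
  intro hsum
  obtain ⟨m, hm⟩ := ((tendsto_sum_nat_add T).eventually_lt_const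
    (by positivity : 0 < 1 / (4 * (1 + |lam|)))).exists
  obtain ⟨n, hn⟩ := hconv.exists_lt_sum_of_sq_le hbot hlsc hr (c := fun n => c (n + m))
    (T := fun n => T (n + m)) (fun n => hc _) (fun n => hT _)
    (fun n => by simpa only [add_right_comm n 1 m] using hdist (n + m))
    (fun n => by simpa only [add_right_comm n 1 m] using hstep (n + m))
  exact (hn.trans_le (((summable_nat_add_iff m).2 hsum).sum_le_tsum _ fun i _ => hT _)).not_gt hm

/-- From the time `a` on, `ξ` follows a gradient curve of the potential restricted to the ball
around `ξ a`, up to the time `b` at which this curve reaches the boundary of the ball. -/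
def IsRestartPiece (φ : X → EReal) (ξ : ℝ≥0 → X) (a : ℝ≥0) (b : ℝ≥0∞) : Prop :=
  ∃ η : ℝ≥0 → X, IsGradientCurve (restrictBall φ (ξ a)) (ξ a) η ∧ b = a + hittingTime (ξ a) η ∧
    ∀ t : ℝ≥0, ((a + t : ℝ≥0) : ℝ≥0∞) ≤ b → ξ (a + t) = η t

lemma isRestartedCurve_iff {x₀ : X} {ξ : ℝ≥0 → X} : IsRestartedCurve φ x₀ ξ ↔
    ξ 0 = x₀ ∧ ∃ s : ℕ → ℝ≥0∞, s 0 = 0 ∧ (∀ t : ℝ≥0, ∃ i, (t : ℝ≥0∞) < s i) ∧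
      ∀ i, ∀ a : ℝ≥0, s i = a → IsRestartPiece φ ξ a (s (i + 1)) := by
  refine and_congr_right' (exists_congr fun s => and_congr_right' (and_congr_right'
    (forall₃_congr fun i a ha => ?_)))
  rw [IsRestartPiece, ha]

section Uniqueness

variable {ξ ζ : ℝ≥0 → X} {a : ℝ≥0} {b b' : ℝ≥0∞}

lemma IsRestartPiece.mem_dom (hξ : IsRestartPiece φ ξ a b) (hbot : ∀ x, φ x ≠ ⊥)
    (hlsc : LowerSemicontinuous φ) (ha : ξ a ∈ dom φ) {t : ℝ≥0} (ht : b = t) : ξ t ∈ dom φ := by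
  obtain ⟨η, hη, hb, hξη⟩ := hξ
  have hat : a ≤ t := by
    rw [← ENNReal.coe_le_coe, ← ht, hb]
    exact le_self_add
  have hadd : a + (t - a) = t := add_tsub_cancel_of_le hat
  rw [← hadd, hξη _ (by rw [hadd, ht])]
  exact hη.mem_dom_of_restrictBall hbot hlsc ha _

lemma IsCAT1.restartPiece_unique [CompleteSpace X] (h : IsCAT1 X) (hbot : ∀ x, φ x ≠ ⊥)
    (hlsc : LowerSemicontinuous φ) {lam : ℝ} (hconv : IsLambdaConvex φ lam)
    (hξ : IsRestartPiece φ ξ a b) (hζ : IsRestartPiece φ ζ a b') (ha : ξ a ∈ dom φ)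
    (hagree : ∀ t ≤ a, ξ t = ζ t) : b = b' ∧ ∀ t : ℝ≥0, t ≤ b → ξ t = ζ t := by
  obtain ⟨η, hη, rfl, hξη⟩ := hξ
  obtain ⟨η', hη', rfl, hζη⟩ := hζ
  rw [← hagree a le_rfl] at hη' hζη ⊢
  obtain rfl : η = η' := (h.eviSetting_restrictBall hbot hlsc hconv (ξ a)).gradientCurve_unique
    (center_mem_dom_restrictBall ha) hη hη'
  refine ⟨rfl, fun t ht => ?_⟩
  rcases le_total t a with hta | hat
  · exact hagree t hta
  · rw [← add_tsub_cancel_of_le hat] at ht ⊢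
    rw [hξη _ ht, hζη _ ht]

lemma IsCAT1.restartedCurve_unique [CompleteSpace X] (h : IsCAT1 X) (hbot : ∀ x, φ x ≠ ⊥)
    (hlsc : LowerSemicontinuous φ) {lam : ℝ} (hconv : IsLambdaConvex φ lam) {x₀ : X}
    (hx₀ : x₀ ∈ dom φ) (hξ : IsRestartedCurve φ x₀ ξ) (hζ : IsRestartedCurve φ x₀ ζ) : ξ = ζ := by
  obtain ⟨hξ0, s, hs0, hexhaust, hs⟩ := isRestartedCurve_iff.1 hξ
  obtain ⟨hζ0, s', hs'0, -, hs'⟩ := isRestartedCurve_iff.1 hζ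
  have hagree (i : ℕ) : (∃ a : ℝ≥0, s i = a ∧ s' i = a ∧ ξ a ∈ dom φ ∧ ∀ t ≤ a, ξ t = ζ t) ∨
      ξ = ζ := by
    induction i with
    | zero =>
      refine Or.inl ⟨0, by simp [hs0], by simp [hs'0], by rwa [hξ0], fun t ht => ?_⟩
      rw [nonpos_iff_eq_zero.1 ht, hξ0, hζ0]
    | succ i ih =>
      rcases ih with ⟨a, ha, ha', hdom, hle⟩ | heq
      · obtain ⟨hsucc, hle_succ⟩ :=
          h.restartPiece_unique hbot hlsc hconv (hs i a ha) (hs' i a ha') hdom hle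
        rcases eq_or_ne (s (i + 1)) ⊤ with htop | hne
        · exact Or.inr (funext fun t => hle_succ t (htop ▸ le_top))
        · have hb := (ENNReal.coe_toNNReal hne).symm
          exact Or.inl ⟨_, hb, hsucc ▸ hb, (hs i a ha).mem_dom hbot hlsc hdom hb,
            fun t ht => hle_succ t (hb ▸ ENNReal.coe_le_coe.2 ht)⟩
      · exact Or.inr heq
  funext t
  obtain ⟨i, hi⟩ := hexhaust t
  rcases hagree i with ⟨a, ha, -, -, hle⟩ | heq
  · exact hle t (ENNReal.coe_lt_coe.1 (ha ▸ hi)).le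
  · exact congrFun heq t

end Uniqueness

lemma exists_concatenation {Y : Type*} {η : ℕ → ℝ≥0 → Y} {T : ℕ → ℝ≥0∞} (hT : ∀ n, 0 < T n)
    (hexhaust : ∀ t : ℝ≥0, ∃ n, (t : ℝ≥0∞) < ∑ i ∈ Finset.range n, T i)
    (hglue : ∀ n (b : ℝ≥0), T n = b → η (n + 1) 0 = η n b) :
    ∃ ξ : ℝ≥0 → Y, ∀ n (a : ℝ≥0), ∑ i ∈ Finset.range n, T i = a →
      ∀ t : ℝ≥0, t ≤ T n → ξ (a + t) = η n t := by
  classical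
  set s : ℕ → ℝ≥0∞ := fun n => ∑ i ∈ Finset.range n, T i
  have hs_succ (n : ℕ) : s (n + 1) = s n + T n := Finset.sum_range_succ T n
  have hmono : Monotone s := monotone_nat_of_le_succ fun n => hs_succ n ▸ le_self_add
  have hex (t : ℝ≥0) : ∃ n, (t : ℝ≥0∞) < s (n + 1) :=
    (hexhaust t).imp fun n hn => hn.trans_le (hmono n.le_succ)
  let ξ : ℝ≥0 → Y := fun t => η (Nat.find (hex t)) (t - (s (Nat.find (hex t))).toNNReal)
  have hlt (n : ℕ) (a t : ℝ≥0) (hn : s n = a) (ht : t < T n) : ξ (a + t) = η n t := by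
    have hfind : Nat.find (hex (a + t)) = n := by
      refine (Nat.find_eq_iff _).2 ⟨?_, fun j hj => not_lt.2 ?_⟩
      · rw [hs_succ, hn, ENNReal.coe_add]
        exact ENNReal.add_lt_add_left ENNReal.coe_ne_top ht
      · exact (hmono hj).trans (hn.trans_le (ENNReal.coe_le_coe.2 le_self_add))
    simp only [ξ, hfind, hn, ENNReal.toNNReal_coe, add_tsub_cancel_left]
  refine ⟨ξ, fun n a (hn : s n = a) t ht => ?_⟩
  rcases ht.lt_or_eq with ht | ht
  · exact hlt n a t hn ht
  · have hnode : s (n + 1) = (a + t : ℝ≥0) := by rw [hs_succ, hn, ← ht, ENNReal.coe_add]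
    rw [← hglue n t ht.symm, ← hlt (n + 1) (a + t) 0 hnode (hT _), add_zero]

section Existence

variable {x₀ : X}

lemma restartedFlow_eq {ξ : ℝ≥0 → X} (hunique : ∃! ξ, IsRestartedCurve φ x₀ ξ)
    (hξ : IsRestartedCurve φ x₀ ξ) (t : ℝ≥0) : restartedFlow φ t x₀ = ξ t :=
  congrFun (hunique.unique (Classical.epsilon_spec ⟨ξ, hξ⟩) hξ) t

lemma stationary_iff_of_eq_until_hittingTime {ξ η : ℝ≥0 → X} (hη : Continuous η) (hη0 : η 0 = x₀)
    (hξη : ∀ t : ℝ≥0, t ≤ hittingTime x₀ η → ξ t = η t) :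
    (∀ t, 0 < t → η t = x₀) ↔ ∀ t, 0 < t → ξ t = x₀ := by
  have heq (hconst : ∀ t : ℝ≥0, t ≤ hittingTime x₀ η → 0 < t → η t = x₀) (t : ℝ≥0) : ξ t = η t := by
    refine hξη t (hittingTime_eq_top hη (fun t ht => ?_) ▸ le_top)
    rcases eq_zero_or_pos t with rfl | hpos
    · exact hη0
    · exact hconst t ht hpos
  exact ⟨fun h t ht => (heq (fun t _ => h t) t).trans (h t ht), fun h t ht =>
    (heq (fun t hle hpos => (hξη t hle).symm.trans (h t hpos)) t).symm.trans (h t ht)⟩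

variable [CompleteSpace X] {lam : ℝ}

lemma IsCAT1.exists_restart_chain (h : IsCAT1 X) (hbot : ∀ x, φ x ≠ ⊥)
    (hlsc : LowerSemicontinuous φ) (hconv : IsLambdaConvex φ lam) (hx₀ : x₀ ∈ dom φ) :
    ∃ (c : ℕ → X) (η : ℕ → ℝ≥0 → X), c 0 = x₀ ∧ ∀ n, c n ∈ dom φ ∧
      IsGradientCurve (restrictBall φ (c n)) (c n) (η n) ∧
      c (n + 1) = η n (hittingTime (c n) (η n)).toNNReal := by
  have hex : ∀ c ∈ dom φ, ∃ η, IsGradientCurve (restrictBall φ c) c η := fun c hc =>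
    (h.eviSetting_restrictBall hbot hlsc hconv c).exists_gradientCurve
      (center_mem_dom_restrictBall hc)
  choose! η hη using hex
  let c : ℕ → X := fun n => Nat.rec x₀ (fun _ z => η z (hittingTime z (η z)).toNNReal) n
  have hc (n : ℕ) : c n ∈ dom φ := by
    induction n with
    | zero => exact hx₀
    | succ n ih => exact (hη _ ih).mem_dom_of_restrictBall hbot hlsc ih _
  exact ⟨c, fun n => η (c n), rfl, fun n => ⟨hc n, hη _ (hc n), rfl⟩⟩

lemma IsCAT1.tsum_hittingTime_eq_top (h : IsCAT1 X) (hbot : ∀ x, φ x ≠ ⊥)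
    (hlsc : LowerSemicontinuous φ) (hconv : IsLambdaConvex φ lam) {c : ℕ → X}
    {η : ℕ → ℝ≥0 → X} (hc : ∀ n, c n ∈ dom φ)
    (hη : ∀ n, IsGradientCurve (restrictBall φ (c n)) (c n) (η n))
    (hsucc : ∀ n, c (n + 1) = η n (hittingTime (c n) (η n)).toNNReal) :
    ∑' n, hittingTime (c n) (η n) = ⊤ := by
  by_contra hne
  have hdist (n : ℕ) : dist (c n) (c (n + 1)) = Real.pi / 6 := by
    rw [hsucc, dist_comm]
    exact dist_eq_of_hittingTime_eq ((h.eviSetting_restrictBall hbot hlsc hconv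
      (c n)).continuous_gradientCurve (center_mem_dom_restrictBall (hc n)) (hη n))
      (ENNReal.coe_toNNReal (ENNReal.ne_top_of_tsum_ne_top hne n)).symm
  refine hconv.not_summable_of_sq_le hbot hlsc (by positivity) hc
    (fun n => ENNReal.toReal_nonneg) hdist (fun n => ?_) (ENNReal.summable_toReal hne)
  have hsq := (hη n).sq_dist_le_of_restrictBall hbot hlsc (hc n) (hittingTime (c n) (η n)).toNNReal
  rwa [← hsucc, hdist] at hsq

lemma IsCAT1.exists_restartedCurve (h : IsCAT1 X) (hbot : ∀ x, φ x ≠ ⊥)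
    (hlsc : LowerSemicontinuous φ) (hconv : IsLambdaConvex φ lam) (hx₀ : x₀ ∈ dom φ) :
    ∃ ξ, IsRestartedCurve φ x₀ ξ := by
  obtain ⟨c, η, hc0, hchain⟩ := h.exists_restart_chain hbot hlsc hconv hx₀
  choose hc hη hsucc using hchain
  have hpos (n : ℕ) : 0 < hittingTime (c n) (η n) :=
    hittingTime_pos ((h.eviSetting_restrictBall hbot hlsc hconv (c n)).continuous_gradientCurve
      (center_mem_dom_restrictBall (hc n)) (hη n)) (hη n).apply_zero
  have hexhaust (t : ℝ≥0) :
      ∃ n, (t : ℝ≥0∞) < ∑ i ∈ Finset.range n, hittingTime (c i) (η i) := by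
    rw [← lt_iSup_iff, ← ENNReal.tsum_eq_iSup_nat,
      h.tsum_hittingTime_eq_top hbot hlsc hconv hc hη hsucc]
    exact ENNReal.coe_lt_top
  obtain ⟨ξ, hξ⟩ := exists_concatenation (η := η) hpos hexhaust fun n b hb => by
    rw [(hη (n + 1)).apply_zero, hsucc, hb, ENNReal.toNNReal_coe]
  have hnode (n : ℕ) (a : ℝ≥0) (ha : ∑ i ∈ Finset.range n, hittingTime (c i) (η i) = a) :
      ξ a = c n := by
    rw [← add_zero a, hξ n a ha 0 zero_le, (hη n).apply_zero]
  refine ⟨ξ, isRestartedCurve_iff.2 ⟨(hnode 0 0 (by simp)).trans hc0, _, Finset.sum_range_zero _,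
    hexhaust, fun n a ha => ?_⟩⟩
  rw [Finset.sum_range_succ, ha, IsRestartPiece, hnode n a ha]
  refine ⟨η n, hη n, rfl, fun t ht => hξ n a ha t ?_⟩
  rwa [ENNReal.coe_add, ENNReal.add_le_add_iff_left ENNReal.coe_ne_top] at ht

lemma IsCAT1.localSlope_eq_zero_iff (h : IsCAT1 X) (hbot : ∀ x, φ x ≠ ⊥)
    (hlsc : LowerSemicontinuous φ) (hconv : IsLambdaConvex φ lam) (hx₀ : x₀ ∈ dom φ)
    {ξ : ℝ≥0 → X} (hξ : IsRestartedCurve φ x₀ ξ) :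
    localSlope φ x₀ = 0 ↔ ∀ t, 0 < t → ξ t = x₀ := by
  have hS := h.eviSetting_restrictBall hbot hlsc hconv x₀
  have hx₀' := center_mem_dom_restrictBall hx₀
  obtain ⟨hξ0, s, hs0, -, hs⟩ := isRestartedCurve_iff.1 hξ
  obtain ⟨η, hη, hs1, hξη⟩ := hs 0 0 hs0
  simp only [hs1, zero_add, ENNReal.coe_zero, hξ0] at hη hξη
  rw [← localSlope_restrictBall,
    hS.localSlope_eq_zero_iff (h.isLambdaConvex_restrictBall hconv x₀) hx₀' hη]
  exact stationary_iff_of_eq_until_hittingTime (hS.continuous_gradientCurve hx₀' hη)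
    hη.apply_zero hξη

lemma IsCAT1.restartedFlow_stationary_iff (h : IsCAT1 X) (hbot : ∀ x, φ x ≠ ⊥)
    (hlsc : LowerSemicontinuous φ) (hconv : IsLambdaConvex φ lam) (hx₀ : x₀ ∈ dom φ) :
    (∃! ξ, IsRestartedCurve φ x₀ ξ) ∧
      (localSlope φ x₀ = 0 ↔ ∀ t : ℝ≥0, 0 < t → restartedFlow φ t x₀ = x₀) := by
  obtain ⟨ξ, hξ⟩ := h.exists_restartedCurve hbot hlsc hconv hx₀
  have hunique : ∃! ξ, IsRestartedCurve φ x₀ ξ :=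
    ⟨ξ, hξ, fun ζ hζ => h.restartedCurve_unique hbot hlsc hconv hx₀ hζ hξ⟩
  simp only [restartedFlow_eq hunique hξ]
  exact ⟨hunique, h.localSlope_eq_zero_iff hbot hlsc hconv hx₀ hξ⟩

end Existence

end Restart

end GradFlow

theorem theorem4p7 {X : Type*} [MetricSpace X] [CompleteSpace X]
    (φ : X → EReal) (hbot : ∀ x, φ x ≠ ⊥) (hlsc : LowerSemicontinuous φ)
    (lam : ℝ) (hconv : IsLambdaConvex φ lam)
    (x₀ : X) (hx₀ : x₀ ∈ dom φ) :
    ((IsCAT1 X ∧ Metric.ediam (Set.univ : Set X) < ENNReal.ofReal (Real.pi / 2)) ∨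
        ((∃ K : ℝ, CommutativeSetting φ lam K) ∧ Coercive φ) →
      (∃! ξ : NNReal → X, IsGradientCurve φ x₀ ξ) ∧
      (localSlope φ x₀ = 0 ↔ ∀ t : NNReal, 0 < t → gradientFlow φ t x₀ = x₀)) ∧
    (IsCAT1 X →
      (∃! ξ : NNReal → X, IsRestartedCurve φ x₀ ξ) ∧
      (localSlope φ x₀ = 0 ↔ ∀ t : NNReal, 0 < t → restartedFlow φ t x₀ = x₀)) := by
  refine ⟨?_, fun h => h.restartedFlow_stationary_iff hbot hlsc hconv hx₀⟩
  rintro (⟨h, hdiam⟩ | ⟨⟨K, h⟩, hcoer⟩)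
  · have htop : Metric.ediam (Set.univ : Set X) ≠ ⊤ := (hdiam.trans ENNReal.ofReal_lt_top).ne
    refine (h.eviSetting hbot hlsc hconv (D := (Metric.ediam (Set.univ : Set X)).toReal)
      ⟨ENNReal.toReal_nonneg, (ENNReal.lt_ofReal_iff_toReal_lt htop).1 hdiam⟩
      fun x _ y _ => ?_).gradientFlow_stationary_iff hconv hx₀
    rw [dist_edist]
    exact ENNReal.toReal_mono htop (Metric.edist_le_ediam_of_mem trivial trivial)
  · exact (h.eviSetting hbot hlsc hcoer).gradientFlow_stationary_iff hconv hx₀
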